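/- Let $M$ be a smooth manifold without boundary (Hausdorff, second countable) of dimension $n$, equipped with a locally finite Borel measure $\mu$, and let $L^2(M)=L^2(M,\mu;\mathbb C)$. Let $\mathbf X=\{X_1,\dots,X_r\}$ be a Hörmander system on $M$, that is, a finite family of smooth real vector fields such that at every $x\in M$ the values at $x$ of the elements of the real Lie algebra of vector fields generated by $\mathbf X$ fill the tangent space $T_xM$. Let $\mathcal L=-\sum_{j=1}^r X_j^2$ be the associated sub-Laplacian. Assume that $\mathcal L$, defined on smooth functions, i.e. with domain $\{f\in C^\infty(M;\mathbb C): f\in L^2(M),\ \mathcal L f\in L^2(M)\}$, is a non-negative essentially self-adjoint operator on $L^2(M)$, and let $\overline{\mathcal L}=\int_{\mathbb R}\lambda\,dE_\lambda$ be the spectral decomposition of its self-adjoint closure, $E$ being its projection-valued spectral measure. (The assumption holds in particular if $\mathcal L$ is non-negative and essentially self-adjoint on $C_0^\infty(M)$.) Let $s>0$ and let $\phi:M\to\mathbb C$ be a smooth function. Then the following are equivalent: i. there exist $A,C>0$ such that $\mathcal L^k\phi\in L^2(M)$ and $\|\mathcal L^k\phi\|_{L^2}\le C A^{2k}\big((2k)!\big)^s$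 for every integer $k\ge 0$, where $\mathcal L^k\phi$ is obtained by applying the differential operator $\mathcal L$ to $\phi$ $k$ times; ii. there exists $D>0$ such that $\|e^{D\mathcal L^{1/(2s)}}\phi\|_{L^2}<\infty$, that is, $\phi\in L^2(M)$ and $\phi$ belongs to the domain of $e^{D\overline{\mathcal L}^{1/(2s)}}$: $\int_{\mathbb R} \big|e^{D\lambda^{1/(2s)}}\big|^2\,d\langle E_\lambda\phi,\phi\rangle<\infty$. -/

import Mathlib

open MeasureTheory
open scoped Manifold ContDiff

noncomputable section

/-! ### Spectral calculus of an unbounded self-adjoint operator -/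

section Spectral

variable {H : Type*} [NormedAddCommGroup H] [InnerProductSpace ℂ H] [CompleteSpace H]

/-- An operator on `H`, given by its graph `Γ`, is essentially self-adjoint: the closure of `Γ`
is the graph of a self-adjoint (single-valued, densely defined) operator. -/
def IsEssentiallySelfAdjoint (Γ : Submodule ℂ (H × H)) : Prop :=
  ∃ A : H →ₗ.[ℂ] H, IsSelfAdjoint A ∧ A.graph = Γ.topologicalClosure

/-- The operator `T` with graph `Γ` is non-negative: `⟨v, T v⟩` is real and non-negative for all
`v` in its domain. -/
def IsNonnegativeOperator (Γ : Submodule ℂ (H × H)) : Prop :=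
  ∀ p ∈ Γ, 0 ≤ (inner ℂ p.1 p.2).re ∧ (inner ℂ p.1 p.2).im = 0

/-- The closure of the operator with graph `Γ`.  If this operator is essentially self-adjoint,
its closure is its unique self-adjoint extension. -/
def operatorClosure (Γ : Submodule ℂ (H × H)) : H →ₗ.[ℂ] H :=
  Γ.topologicalClosure.toLinearPMap

theorem IsEssentiallySelfAdjoint.closure_spec {Γ : Submodule ℂ (H × H)}
    (h : IsEssentiallySelfAdjoint Γ) :
    IsSelfAdjoint (operatorClosure Γ) ∧ (operatorClosure Γ).graph = Γ.topologicalClosure := by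
  obtain ⟨A, hA, hgr⟩ := h
  have hg : (operatorClosure Γ).graph = Γ.topologicalClosure := by
    refine Submodule.toLinearPMap_graph_eq _ ?_
    intro x hx hx0
    rw [← hgr] at hx
    exact LinearPMap.graph_fst_eq_zero_snd A (x := x.1) (x' := x.2) hx hx0
  have : operatorClosure Γ = A := LinearPMap.eq_of_eq_graph (hg.trans hgr.symm)
  exact ⟨this ▸ hA, hg⟩

variable (H) in
/-- A projection-valued measure on the Borel sets of `ℝ`, with values in the orthogonal
projections of `H`. The values on non-measurable sets are irrelevant. -/
structure ProjectionValuedMeasure where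
  proj : Set ℝ → H →L[ℂ] H
  isStarProjection : ∀ S, MeasurableSet S → IsStarProjection (proj S)
  proj_empty : proj ∅ = 0
  proj_univ : proj Set.univ = 1
  proj_inter : ∀ S T, MeasurableSet S → MeasurableSet T → proj (S ∩ T) = proj S * proj T
  hasSum_proj : ∀ S : ℕ → Set ℝ, (∀ i, MeasurableSet (S i)) →
    Pairwise (Function.onFun Disjoint S) → ∀ v : H,
    HasSum (fun i => proj (S i) v) (proj (⋃ i, S i) v)

namespace ProjectionValuedMeasure

variable (E : ProjectionValuedMeasure H)

theorem re_inner_nonneg {S : Set ℝ} (hS : MeasurableSet S) (v : H) :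
    0 ≤ (inner ℂ v (E.proj S v)).re := by
  have h := E.isStarProjection S hS
  have h1 : E.proj S (E.proj S v) = E.proj S v := congrArg (· v) h.isIdempotentElem.eq
  have h2 : inner ℂ v (E.proj S (E.proj S v)) = inner ℂ (E.proj S v) (E.proj S v) := by
    have h3 := ContinuousLinearMap.adjoint_inner_left (E.proj S) (E.proj S v) v
    rwa [ContinuousLinearMap.isSelfAdjoint_iff'.mp h.isSelfAdjoint, eq_comm] at h3
  rw [← h1, h2]
  exact inner_self_nonneg (𝕜 := ℂ) (x := E.proj S v)

/-- The finite Borel measure `S ↦ ⟨v, E(S) v⟩` on `ℝ`. -/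
def scalarMeasure (v : H) : Measure ℝ :=
  Measure.ofMeasurable (fun S _ => ENNReal.ofReal (inner ℂ v (E.proj S v)).re)
    (by simp [E.proj_empty])
    (by
      intro S hS hd
      have h1 := (E.hasSum_proj S hS hd v).mapL (Complex.reCLM.comp
        ((innerSL ℂ v).restrictScalars ℝ))
      have h2 : HasSum (fun i => (inner ℂ v (E.proj (S i) v)).re)
          (inner ℂ v (E.proj (⋃ i, S i) v)).re := by simpa using h1
      rw [← h2.tsum_eq, ENNReal.ofReal_tsum_of_nonneg
        (fun i => E.re_inner_nonneg (hS i) v) h2.summable])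

/-- `A = ∫ λ dE(λ)`: the domain of `A` consists of the `v` with `∫ λ² d⟨v, E(λ) v⟩ < ∞`, and
`⟨v, A v⟩ = ∫ λ d⟨v, E(λ) v⟩` for these `v`. -/
def IsSpectralMeasureOf (A : H →ₗ.[ℂ] H) : Prop :=
  (∀ v : H, v ∈ A.domain ↔ ∫⁻ t, ENNReal.ofReal (t ^ 2) ∂(E.scalarMeasure v) < ⊤) ∧
  ∀ v : A.domain, inner ℂ (v : H) (A v) = ((∫ t, t ∂(E.scalarMeasure v) : ℝ) : ℂ)

end ProjectionValuedMeasure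

/-- The domain of `g(A) = ∫ g(λ) dE(λ)`, where `E` is the spectral measure of `A`: all `v` with
`∫ |g(λ)|² d⟨v, E(λ) v⟩ < ∞`.  This integral is `‖g(A) v‖²`. -/
def functionalCalculusDomain (A : H →ₗ.[ℂ] H) (g : ℝ → ℝ) : Set H :=
  {v | ∃ E : ProjectionValuedMeasure H, E.IsSpectralMeasureOf A ∧
    ∫⁻ t, ENNReal.ofReal (|g t| ^ 2) ∂(E.scalarMeasure v) < ⊤}

end Spectral

/-! ### Hörmander systems and sub-Laplacians -/

section SubLaplacian

variable {n : ℕ} {M : Type*} [TopologicalSpace M] [ChartedSpace (EuclideanSpace ℝ (Fin n)) M]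

/-- The real Lie algebra of vector fields generated by `X 0, …, X (r - 1)`. -/
inductive LieGenerated {r : ℕ} (X : Fin r → (x : M) → TangentSpace (𝓡 n) x) :
    ((x : M) → TangentSpace (𝓡 n) x) → Prop
  | base (j : Fin r) : LieGenerated X (X j)
  | zero : LieGenerated X 0
  | add {V W : (x : M) → TangentSpace (𝓡 n) x} :
      LieGenerated X V → LieGenerated X W → LieGenerated X (V + W)
  | smul (c : ℝ) {V : (x : M) → TangentSpace (𝓡 n) x} :
      LieGenerated X V → LieGenerated X (c • V)
  | bracket {V W : (x : M) → TangentSpace (𝓡 n) x} :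
      LieGenerated X V → LieGenerated X W →
      LieGenerated X (VectorField.mlieBracket (𝓡 n) V W)

/-- A Hörmander system on `M`: smooth real vector fields which generate a Lie algebra whose values
at every point `x` fill the tangent space at `x`. -/
structure IsHormanderSystem {r : ℕ} [IsManifold (𝓡 n) ∞ M]
    (X : Fin r → (x : M) → TangentSpace (𝓡 n) x) : Prop where
  smooth : ∀ j, ContMDiff (𝓡 n) (𝓡 n).tangent ∞
    (fun x => (⟨x, X j x⟩ : TangentBundle (𝓡 n) M))
  span : ∀ (x : M) (v : TangentSpace (𝓡 n) x), ∃ V, LieGenerated X V ∧ V x = v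

/-- The derivative `V f` of a complex-valued function `f` along a vector field `V`. -/
def applyField (V : (x : M) → TangentSpace (𝓡 n) x) (f : M → ℂ) : M → ℂ :=
  fun x => mfderiv (𝓡 n) 𝓘(ℝ, ℂ) f x (V x)

/-- The sub-Laplacian `L f = -∑ⱼ Xⱼ (Xⱼ f)`. -/
def subLaplacian {r : ℕ} (X : Fin r → (x : M) → TangentSpace (𝓡 n) x) (f : M → ℂ) : M → ℂ :=
  fun x => -∑ j, applyField (X j) (applyField (X j) f) x

theorem applyField_add {V : (x : M) → TangentSpace (𝓡 n) x} {f g : M → ℂ}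
    (hf : ContMDiff (𝓡 n) 𝓘(ℝ, ℂ) ∞ f) (hg : ContMDiff (𝓡 n) 𝓘(ℝ, ℂ) ∞ g) :
    applyField V (f + g) = applyField V f + applyField V g := by
  funext x
  have := mfderiv_add (hf.mdifferentiable (by simp) x) (hg.mdifferentiable (by simp) x)
  simp only [applyField, Pi.add_apply]
  rw [this]
  rfl

theorem applyField_smul {V : (x : M) → TangentSpace (𝓡 n) x} {f : M → ℂ} (c : ℂ)
    (hf : ContMDiff (𝓡 n) 𝓘(ℝ, ℂ) ∞ f) :
    applyField V (c • f) = c • applyField V f := by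
  funext x
  let l : ℂ →L[ℝ] ℂ := c • ContinuousLinearMap.id ℝ ℂ
  have h : HasMFDerivAt (𝓡 n) 𝓘(ℝ, ℂ) (l ∘ f) x _ :=
    (l.hasMFDerivAt (x := f x)).comp x (hf.mdifferentiable (by simp) x).hasMFDerivAt
  have h' : c • f = l ∘ f := by funext y; simp [l]
  simp only [applyField, Pi.smul_apply]
  rw [h', h.mfderiv]
  rfl

theorem contMDiff_applyField [IsManifold (𝓡 n) ∞ M] {V : (x : M) → TangentSpace (𝓡 n) x}
    (hV : ContMDiff (𝓡 n) (𝓡 n).tangent ∞ (fun x => (⟨x, V x⟩ : TangentBundle (𝓡 n) M)))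
    {f : M → ℂ} (hf : ContMDiff (𝓡 n) 𝓘(ℝ, ℂ) ∞ f) :
    ContMDiff (𝓡 n) 𝓘(ℝ, ℂ) ∞ (applyField V f) :=
  (contMDiff_snd_tangentBundle_modelSpace ℂ 𝓘(ℝ, ℂ)).comp
    ((hf.contMDiff_tangentMap (m := ∞) (by simp)).comp hV)

theorem subLaplacian_add [IsManifold (𝓡 n) ∞ M] {r : ℕ}
    {X : Fin r → (x : M) → TangentSpace (𝓡 n) x} (hX : IsHormanderSystem X) {f g : M → ℂ}
    (hf : ContMDiff (𝓡 n) 𝓘(ℝ, ℂ) ∞ f) (hg : ContMDiff (𝓡 n) 𝓘(ℝ, ℂ) ∞ g) :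
    subLaplacian X (f + g) = subLaplacian X f + subLaplacian X g := by
  funext x
  simp only [subLaplacian, Pi.add_apply, ← neg_add, ← Finset.sum_add_distrib]
  congr 1
  refine Finset.sum_congr rfl fun j _ => ?_
  rw [applyField_add hf hg, applyField_add (contMDiff_applyField (hX.smooth j) hf)
    (contMDiff_applyField (hX.smooth j) hg)]
  rfl

theorem subLaplacian_smul [IsManifold (𝓡 n) ∞ M] {r : ℕ}
    {X : Fin r → (x : M) → TangentSpace (𝓡 n) x} (hX : IsHormanderSystem X) {f : M → ℂ} (c : ℂ)
    (hf : ContMDiff (𝓡 n) 𝓘(ℝ, ℂ) ∞ f) :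
    subLaplacian X (c • f) = c • subLaplacian X f := by
  funext x
  simp only [subLaplacian, Pi.smul_apply, smul_neg, Finset.smul_sum]
  congr 1
  refine Finset.sum_congr rfl fun j _ => ?_
  rw [applyField_smul c hf, applyField_smul c (contMDiff_applyField (hX.smooth j) hf)]
  rfl

/-- The sub-Laplacian, defined on the smooth functions, as an operator on `L²(M, μ)`: the graph
consisting of the pairs `(f, L f)` with `f` smooth and both `f` and `L f` square-integrable. -/
def subLaplacianGraph [IsManifold (𝓡 n) ∞ M] [MeasurableSpace M] (μ : Measure M) {r : ℕ}
    {X : Fin r → (x : M) → TangentSpace (𝓡 n) x} (hX : IsHormanderSystem X) :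
    Submodule ℂ (Lp ℂ 2 μ × Lp ℂ 2 μ) where
  carrier := {p | ∃ f : M → ℂ, ContMDiff (𝓡 n) 𝓘(ℝ, ℂ) ∞ f ∧
    ∃ (hf : MemLp f 2 μ) (hLf : MemLp (subLaplacian X f) 2 μ), p = (hf.toLp f, hLf.toLp _)}
  zero_mem' := by
    have h0 : subLaplacian X (0 : M → ℂ) = 0 := by
      simpa using subLaplacian_smul hX (f := (0 : M → ℂ)) 0 contMDiff_const
    exact ⟨0, contMDiff_const, MemLp.zero, by rw [h0]; exact MemLp.zero, by
      simp only [h0]; rfl⟩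
  add_mem' := by
    rintro _ _ ⟨f, hf, hf2, hLf, rfl⟩ ⟨g, hg, hg2, hLg, rfl⟩
    have h := subLaplacian_add hX hf hg
    exact ⟨f + g, hf.add hg, hf2.add hg2, h ▸ hLf.add hLg, by
      simp only [h]; rfl⟩
  smul_mem' := by
    rintro c _ ⟨f, hf, hf2, hLf, rfl⟩
    have h := subLaplacian_smul hX c hf
    refine ⟨c • f, ?_, hf2.const_smul c, h ▸ hLf.const_smul c, by
      simp only [h]; rfl⟩
    exact (c • ContinuousLinearMap.id ℝ ℂ).contMDiff.comp hf

end SubLaplacian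

end

/-!
A non-negative self-adjoint operator `A` has a spectral measure: by the Riesz–Markov–Kakutani
theorem, the continuous functional calculus of its resolvent `R = (1 + A)⁻¹` extends to `L²`
functions, giving spectral projections of `R`, and `t ↦ t⁻¹ - 1` transports these to `A`. As
`‖A ^ k v‖² = ∫ t ^ (2 * k) d⟨v, E(t) v⟩`, growth of these norms like `((2 * k)!) ^ s` amounts to
integrability of `exp (2 D t ^ (1 / (2 * s)))` for some `D > 0`: one direction is the estimate
`y ^ m ≤ m! exp y`, the other bounds the exponential by a weighted series of powers whose
integrals are dominated by a geometric series.

It remains to see that the powers of the closure of `L` at a smooth function are given by applying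
`L` as a differential operator. As `L` does not enlarge supports, it is symmetric on pairs of
smooth functions only one of which has compact support, so if the closure maps `f` to `g`, then
`∫ h g = ∫ (L h) f = ∫ h (L f)` for all real test functions `h`, and `g = L f` almost everywhere.
-/

/-! ### `L²` functional calculi -/

section L2Norm

variable {α : Type*} [MeasurableSpace α] {ν : Measure α}

theorem enorm_sq_eq_ofReal_sq (t : ℝ) : ‖t‖ₑ ^ 2 = ENNReal.ofReal (t ^ 2) := by
  rw [Real.enorm_eq_ofReal_abs, ← ENNReal.ofReal_pow (abs_nonneg _), sq_abs]

theorem eLpNorm_two_sq_eq_lintegral (g : α → ℝ) (ν : Measure α) :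
    eLpNorm g 2 ν ^ 2 = ∫⁻ x, ENNReal.ofReal (g x ^ 2) ∂ν := by
  simpa [enorm_sq_eq_ofReal_sq] using
    eLpNorm_nnreal_pow_eq_lintegral (μ := ν) (f := g) (p := 2) (by simp)

theorem memLp_two_iff_lintegral_lt_top {g : α → ℝ} (hg : AEStronglyMeasurable g ν) :
    MemLp g 2 ν ↔ ∫⁻ x, ENNReal.ofReal (g x ^ 2) ∂ν < ⊤ := by
  rw [← eLpNorm_two_sq_eq_lintegral, ENNReal.pow_lt_top_iff]
  simp [MemLp, hg]

theorem memLp_two_add_measure {ν' : Measure α} {g : α → ℝ} (h : MemLp g 2 ν)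
    (h' : MemLp g 2 ν') : MemLp g 2 (ν + ν') := by
  rw [memLp_two_iff_integrable_sq (h.aestronglyMeasurable.add_measure h'.aestronglyMeasurable)]
  exact h.integrable_sq.add_measure h'.integrable_sq

theorem eLpNorm_two_withDensity_enorm_sq {g : α → ℝ} (hg : AEStronglyMeasurable g ν)
    (h : α → ℝ) : eLpNorm h 2 (ν.withDensity fun x => ‖g x‖ₑ ^ 2) = eLpNorm (h * g) 2 ν := by
  refine (ENNReal.pow_right_strictMono two_ne_zero).injective ?_
  rw [eLpNorm_two_sq_eq_lintegral, eLpNorm_two_sq_eq_lintegral,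
    lintegral_withDensity_eq_lintegral_mul_non_measurable₀ _ (hg.enorm.pow_const 2)
      (ae_of_all _ fun x => ENNReal.pow_lt_top enorm_lt_top)]
  refine lintegral_congr fun x => ?_
  simp only [Pi.mul_apply, enorm_sq_eq_ofReal_sq, ← ENNReal.ofReal_mul (sq_nonneg (g x)),
    mul_pow, mul_comm]

theorem isFiniteMeasure_withDensity_enorm_sq {g : α → ℝ} (hg : MemLp g 2 ν) :
    IsFiniteMeasure (ν.withDensity fun x => ‖g x‖ₑ ^ 2) := by
  refine isFiniteMeasure_withDensity ?_
  simpa only [enorm_sq_eq_ofReal_sq] using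
    ((memLp_two_iff_lintegral_lt_top hg.aestronglyMeasurable).1 hg).ne

theorem memLp_indicator_one [IsFiniteMeasure ν] {S : Set α} (hS : MeasurableSet S) :
    MemLp (S.indicator (1 : α → ℝ)) 2 ν :=
  memLp_indicator_const 2 hS 1 (.inr (measure_ne_top _ _))

theorem eLpNorm_two_indicator_one {S : Set α} (hS : MeasurableSet S) :
    eLpNorm (S.indicator (1 : α → ℝ)) 2 ν = ν S ^ (1 / 2 : ℝ) := by
  simpa [Pi.one_def] using
    eLpNorm_indicator_const (μ := ν) (c := (1 : ℝ)) hS two_ne_zero ENNReal.ofNat_ne_top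

end L2Norm

section L2Calculus

open Filter Topology
open scoped ENNReal

/-- A calculus of bounded operators `op f` with bounded real symbols `sym f`, the symbols being
dense in every space `L²(ν)` with `ν` finite, and with `⟨v, op f v⟩ = ∫ sym f d(meas v)`. The
continuous functional calculus of a bounded self-adjoint operator and the integral of simple
functions against a projection-valued measure are of this kind. -/
structure L2Calculus (H : Type*) [NormedAddCommGroup H] [InnerProductSpace ℂ H] [CompleteSpace H]
    (α : Type*) [MeasurableSpace α] (V : Type*) [Ring V] [Algebra ℝ V] where
  sym : V →ₐ[ℝ] (α → ℝ)
  op : V →ₐ[ℝ] (H →L[ℂ] H)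
  meas : H → Measure α
  isFiniteMeasure_meas : ∀ v, IsFiniteMeasure (meas v)
  measurable_sym : ∀ f, Measurable (sym f)
  exists_bound_sym : ∀ f, ∃ c : ℝ, ∀ x, |sym f x| ≤ c
  inner_op : ∀ f v, inner ℂ v (op f v) = ((∫ x, sym f x ∂(meas v) : ℝ) : ℂ)
  exists_approx : ∀ (ν : Measure α) [IsFiniteMeasure ν] (g : α → ℝ), MemLp g 2 ν →
    ∀ ε : ℝ≥0∞, ε ≠ 0 → ∃ f, eLpNorm (g - sym f) 2 ν ≤ ε

namespace L2Calculus

variable {H : Type*} [NormedAddCommGroup H] [InnerProductSpace ℂ H] [CompleteSpace H]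
  {α : Type*} [MeasurableSpace α] {V : Type*} [Ring V] [Algebra ℝ V] (C : L2Calculus H α V)
  {ν ν' : Measure α} {g g' : α → ℝ} {v v' w w' : H}

instance (v : H) : IsFiniteMeasure (C.meas v) := C.isFiniteMeasure_meas v

theorem memLp_sym (f : V) (ν : Measure α) [IsFiniteMeasure ν] : MemLp (C.sym f) 2 ν := by
  obtain ⟨c, hc⟩ := C.exists_bound_sym f
  exact MemLp.of_bound (C.measurable_sym f).aestronglyMeasurable c (ae_of_all _ hc)

theorem inner_op_left (f : V) (v w : H) : inner ℂ (C.op f v) w = inner ℂ v (C.op f w) := by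
  have h : (C.op f : H →ₗ[ℂ] H).IsSymmetric := by
    rw [LinearMap.isSymmetric_iff_inner_map_self_real]
    intro v
    rw [ContinuousLinearMap.coe_coe, inner_conj_symm, ← inner_conj_symm (C.op f v), C.inner_op,
      Complex.conj_ofReal]
  exact h v w

theorem enorm_op (f : V) (v : H) : ‖C.op f v‖ₑ = eLpNorm (C.sym f) 2 (C.meas v) := by
  refine (ENNReal.pow_right_strictMono two_ne_zero).injective ?_
  have hsq : ‖C.op f v‖ ^ 2 = ∫ x, C.sym f x ^ 2 ∂(C.meas v) := by
    refine Complex.ofReal_injective ?_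
    have h := C.inner_op (f * f) v
    rw [map_mul, mul_apply_eq_comp, ← C.inner_op_left, inner_self_eq_norm_sq_to_K] at h
    simpa [pow_two] using h
  rw [eLpNorm_two_sq_eq_lintegral, ← ofReal_integral_eq_lintegral_ofReal
    (C.memLp_sym f _).integrable_sq (ae_of_all _ fun x => sq_nonneg _), ← hsq,
    ENNReal.ofReal_pow (norm_nonneg _), ofReal_norm]

theorem enorm_op_sub (f f' : V) (v : H) :
    ‖C.op f v - C.op f' v‖ₑ = eLpNorm (C.sym f - C.sym f') 2 (C.meas v) := by
  rw [← sub_apply, ← map_sub, C.enorm_op, map_sub]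

/-- The filter of approximants: `f` tends to it when `sym f` converges to `g` in `L²(ν)`. -/
noncomputable def approx (ν : Measure α) (g : α → ℝ) : Filter V :=
  comap (fun f => eLpNorm (g - C.sym f) 2 ν) (𝓝 0)

theorem tendsto_approx (ν : Measure α) (g : α → ℝ) :
    Tendsto (fun f => eLpNorm (g - C.sym f) 2 ν) (C.approx ν g) (𝓝 0) :=
  tendsto_comap

variable {C} in
theorem tendsto_approx_of_le {ι : Type*} {l : Filter ι} {u : ι → V} {B : ι → ℝ≥0∞}
    (hB : Tendsto B l (𝓝 0)) (h : ∀ i, eLpNorm (g - C.sym (u i)) 2 ν ≤ B i) :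
    Tendsto u l (C.approx ν g) :=
  tendsto_comap_iff.2 <|
    tendsto_of_tendsto_of_tendsto_of_le_of_le tendsto_const_nhds hB (fun _ => zero_le) h

theorem approx_neBot [IsFiniteMeasure ν] (hg : MemLp g 2 ν) : (C.approx ν g).NeBot :=
  (ENNReal.nhds_zero_basis_Iic.comap _).neBot_iff.2 fun hε => C.exists_approx ν g hg _ hε.ne'

theorem approx_mono (h : ν ≤ ν') (g : α → ℝ) : C.approx ν' g ≤ C.approx ν g :=
  tendsto_id'.1 <| tendsto_approx_of_le (C.tendsto_approx ν' g) fun _ =>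
    eLpNorm_mono_measure _ h

theorem approx_add_le_left (ν ν' : Measure α) (g : α → ℝ) :
    C.approx (ν + ν') g ≤ C.approx ν g :=
  C.approx_mono (Measure.le_add_right le_rfl) g

theorem approx_add_le_right (ν ν' : Measure α) (g : α → ℝ) :
    C.approx (ν + ν') g ≤ C.approx ν' g :=
  C.approx_mono (Measure.le_add_left le_rfl) g

theorem tendsto_eLpNorm_sym [IsFiniteMeasure ν] (hg : MemLp g 2 ν) :
    Tendsto (fun f => eLpNorm (C.sym f) 2 ν) (C.approx ν g) (𝓝 (eLpNorm g 2 ν)) := by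
  have hsub f := hg.aestronglyMeasurable.sub (C.memLp_sym f ν).aestronglyMeasurable
  refine tendsto_of_tendsto_of_tendsto_of_le_of_le
    (g := fun f => eLpNorm g 2 ν - eLpNorm (g - C.sym f) 2 ν)
    (h := fun f => eLpNorm g 2 ν + eLpNorm (g - C.sym f) 2 ν) ?_ ?_ (fun f => ?_) (fun f => ?_)
  · simpa using ENNReal.Tendsto.sub (tendsto_const_nhds (x := eLpNorm g 2 ν))
      (C.tendsto_approx ν g) (.inl hg.eLpNorm_ne_top)
  · simpa using (tendsto_const_nhds (x := eLpNorm g 2 ν)).add (C.tendsto_approx ν g)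
  · rw [tsub_le_iff_left]
    simpa using eLpNorm_add_le (hsub f) (C.memLp_sym f ν).aestronglyMeasurable (p := 2)
      (by norm_num)
  · simpa using eLpNorm_sub_le hg.aestronglyMeasurable (hsub f) (p := 2) (by norm_num)

theorem measure_eq_of_eLpNorm_sym_eq [IsFiniteMeasure ν] [IsFiniteMeasure ν']
    (h : ∀ f, eLpNorm (C.sym f) 2 ν = eLpNorm (C.sym f) 2 ν') : ν = ν' := by
  ext S hS
  have := C.approx_neBot (memLp_indicator_one (ν := ν + ν') hS)
  have h1 := (C.tendsto_eLpNorm_sym (memLp_indicator_one (ν := ν) hS)).mono_left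
    (C.approx_add_le_left ν ν' _)
  have h2 := (C.tendsto_eLpNorm_sym (memLp_indicator_one (ν := ν') hS)).mono_left
    (C.approx_add_le_right ν ν' _)
  simp only [h] at h1
  have h3 := tendsto_nhds_unique h1 h2
  rw [eLpNorm_two_indicator_one hS, eLpNorm_two_indicator_one hS] at h3
  exact ENNReal.rpow_left_injective (by norm_num) h3

/-- `w = g(T) v`, in terms of the isometry from `L²(meas v)` to `H` sending `sym f` to `op f v`. -/
structure IsValue (v : H) (g : α → ℝ) (w : H) : Prop where
  memLp : MemLp g 2 (C.meas v)
  tendsto : Tendsto (fun f => C.op f v) (C.approx (C.meas v) g) (𝓝 w)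

theorem exists_isValue (v : H) (hg : MemLp g 2 (C.meas v)) : ∃ w, C.IsValue v g w := by
  have := C.approx_neBot hg
  have hc : Cauchy (map (fun f => C.op f v) (C.approx (C.meas v) g)) := by
    refine cauchy_map_iff.2 ⟨this, ?_⟩
    rw [uniformity_eq_comap_nhds_zero, tendsto_comap_iff, tendsto_zero_iff_enorm_tendsto_zero]
    have hB := ((C.tendsto_approx (C.meas v) g).comp tendsto_snd).add
      ((C.tendsto_approx (C.meas v) g).comp tendsto_fst)
    refine tendsto_of_tendsto_of_tendsto_of_le_of_le tendsto_const_nhds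
      (by rwa [add_zero] at hB) (fun _ => zero_le) fun f => ?_
    have hm f := hg.aestronglyMeasurable.sub (C.memLp_sym f (C.meas v)).aestronglyMeasurable
    simpa [enorm_op_sub, edist_eq_enorm_sub, add_comm] using
      eLpNorm_sub_le (hm f.1) (hm f.2) (p := 2) (by norm_num)
  obtain ⟨w, hw⟩ := CompleteSpace.complete hc
  exact ⟨w, hg, hw⟩

variable {C}

theorem IsValue.unique (h : C.IsValue v g w) (h' : C.IsValue v g w') : w = w' :=
  have := C.approx_neBot h.memLp
  tendsto_nhds_unique h.tendsto h'.tendsto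

theorem IsValue.of_tendsto {ι : Type*} {l : Filter ι} [l.NeBot] {u : ι → V}
    (hg : MemLp g 2 (C.meas v)) (hu : Tendsto u l (C.approx (C.meas v) g))
    (hw : Tendsto (fun i => C.op (u i) v) l (𝓝 w)) : C.IsValue v g w := by
  obtain ⟨z, hz⟩ := C.exists_isValue v hg
  rwa [tendsto_nhds_unique hw (hz.tendsto.comp hu)]

theorem IsValue.congr (h : C.IsValue v g w) (hg : g =ᵐ[C.meas v] g') : C.IsValue v g' w := by
  refine ⟨(memLp_congr_ae hg).1 h.memLp, ?_⟩
  have : C.approx (C.meas v) g' = C.approx (C.meas v) g := by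
    simp only [approx, eLpNorm_congr_ae (hg.symm.sub (ae_eq_refl _))]
  exact this ▸ h.tendsto

theorem IsValue.enorm (h : C.IsValue v g w) : ‖w‖ₑ = eLpNorm g 2 (C.meas v) := by
  have := C.approx_neBot h.memLp
  refine tendsto_nhds_unique h.tendsto.enorm ?_
  simpa only [C.enorm_op] using C.tendsto_eLpNorm_sym h.memLp

variable (C) in
theorem isValue_op (f : V) (v : H) : C.IsValue v (C.sym f) (C.op f v) :=
  .of_tendsto (l := pure ()) (u := fun _ => f) (C.memLp_sym f _)
    (tendsto_approx_of_le tendsto_const_nhds fun _ => by simp) tendsto_const_nhds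

variable (C) in
theorem isValue_one (v : H) : C.IsValue v 1 v := by
  simpa using C.isValue_op 1 v

variable (C) in
theorem isValue_zero (v : H) : C.IsValue v 0 0 := by
  simpa using C.isValue_op 0 v

theorem IsValue.add (h : C.IsValue v g w) (h' : C.IsValue v g' w') :
    C.IsValue v (g + g') (w + w') := by
  have := C.approx_neBot h.memLp
  have := C.approx_neBot h'.memLp
  have hB := ((C.tendsto_approx (C.meas v) g).comp (tendsto_fst (g := C.approx (C.meas v) g'))).add
    ((C.tendsto_approx (C.meas v) g').comp tendsto_snd)
  rw [add_zero] at hB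
  refine .of_tendsto (u := fun f => f.1 + f.2) (h.memLp.add h'.memLp)
    (tendsto_approx_of_le hB fun f => ?_) ?_
  · rw [map_add, add_sub_add_comm]
    exact eLpNorm_add_le (h.memLp.sub (C.memLp_sym _ _)).aestronglyMeasurable
      (h'.memLp.sub (C.memLp_sym _ _)).aestronglyMeasurable (by norm_num)
  · simpa using (h.tendsto.comp tendsto_fst).add (h'.tendsto.comp tendsto_snd)

theorem IsValue.sum {ι : Type*} {s : Finset ι} {g : ι → α → ℝ} {w : ι → H}
    (h : ∀ i ∈ s, C.IsValue v (g i) (w i)) : C.IsValue v (∑ i ∈ s, g i) (∑ i ∈ s, w i) := by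
  classical
  induction s using Finset.induction_on with
  | empty => simpa using C.isValue_zero v
  | insert i s hi ih =>
    rw [Finset.sum_insert hi, Finset.sum_insert hi]
    exact (h i (s.mem_insert_self i)).add (ih fun j hj => h j (Finset.mem_insert_of_mem hj))

theorem IsValue.op_mul (h : C.IsValue v g w) (p : V) :
    C.IsValue v (C.sym p * g) (C.op p w) := by
  have := C.approx_neBot h.memLp
  obtain ⟨c, hc⟩ := C.exists_bound_sym p
  have hp : AEStronglyMeasurable (C.sym p) (C.meas v) :=
    (C.measurable_sym p).aestronglyMeasurable
  have hbound (g : α → ℝ) : eLpNorm (C.sym p * g) 2 (C.meas v) ≤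
      ENNReal.ofReal c * eLpNorm g 2 (C.meas v) :=
    eLpNorm_le_mul_eLpNorm_of_ae_le_mul (ae_of_all _ fun x => by
      simpa [abs_mul] using mul_le_mul_of_nonneg_right (hc x) (abs_nonneg (g x))) _
  have hB := ENNReal.Tendsto.const_mul (C.tendsto_approx (C.meas v) g)
    (.inr (ENNReal.ofReal_ne_top (r := c)))
  rw [mul_zero] at hB
  refine .of_tendsto (u := fun f => p * f) ⟨hp.mul h.memLp.aestronglyMeasurable,
    (hbound g).trans_lt (ENNReal.mul_lt_top ENNReal.ofReal_lt_top h.memLp.eLpNorm_lt_top)⟩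
    (tendsto_approx_of_le hB fun f => ?_) ?_
  · rw [map_mul, ← mul_sub]
    exact hbound _
  · simpa [Function.comp_def] using ((C.op p).continuous.tendsto w).comp h.tendsto

theorem IsValue.sub (h : C.IsValue v g w) (h' : C.IsValue v g' w') :
    C.IsValue v (g - g') (w - w') := by
  simpa [sub_eq_add_neg] using h.add (h'.op_mul (-1))

theorem IsValue.of_tendsto_isValue {ι : Type*} {l : Filter ι} [l.NeBot] {u : ι → α → ℝ}
    {z : ι → H} (hg : MemLp g 2 (C.meas v)) (hu : ∀ i, C.IsValue v (u i) (z i))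
    (hug : Tendsto (fun i => eLpNorm (g - u i) 2 (C.meas v)) l (𝓝 0))
    (hw : Tendsto z l (𝓝 w)) : C.IsValue v g w := by
  obtain ⟨w', hw'⟩ := C.exists_isValue v hg
  suffices Tendsto z l (𝓝 w') from tendsto_nhds_unique this hw ▸ hw'
  rw [tendsto_iff_edist_tendsto_0]
  exact hug.congr fun i => by rw [edist_comm, edist_eq_enorm_sub, (hw'.sub (hu i)).enorm]

theorem IsValue.add_vector (h : C.IsValue v g w) (h' : C.IsValue v' g w')
    (hg : MemLp g 2 (C.meas (v + v'))) : C.IsValue (v + v') g (w + w') := by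
  have : (C.approx (C.meas v + C.meas v' + C.meas (v + v')) g).NeBot :=
    C.approx_neBot (memLp_two_add_measure (memLp_two_add_measure h.memLp h'.memLp) hg)
  have hl := C.approx_add_le_left (C.meas v + C.meas v') (C.meas (v + v')) g
  refine .of_tendsto hg (tendsto_id'.2 (C.approx_add_le_right (C.meas v + C.meas v') _ g)) ?_
  simpa using (h.tendsto.mono_left (hl.trans (C.approx_add_le_left _ _ g))).add
    (h'.tendsto.mono_left (hl.trans (C.approx_add_le_right _ _ g)))

theorem IsValue.smul_vector (h : C.IsValue v g w) (c : ℂ) (hg : MemLp g 2 (C.meas (c • v))) :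
    C.IsValue (c • v) g (c • w) := by
  have : (C.approx (C.meas v + C.meas (c • v)) g).NeBot :=
    C.approx_neBot (memLp_two_add_measure h.memLp hg)
  refine .of_tendsto hg (tendsto_id'.2 (C.approx_add_le_right (C.meas v) _ g)) ?_
  simpa using (h.tendsto.mono_left (C.approx_add_le_left _ _ g)).const_smul c

theorem IsValue.inner_comm (h : C.IsValue v g w) (h' : C.IsValue v' g w') :
    inner ℂ w v' = inner ℂ v w' := by
  have : (C.approx (C.meas v + C.meas v') g).NeBot :=
    C.approx_neBot (memLp_two_add_measure h.memLp h'.memLp)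
  have h1 : Tendsto (fun f => inner ℂ (C.op f v) v') (C.approx (C.meas v + C.meas v') g)
      (𝓝 (inner ℂ w v')) :=
    (h.tendsto.mono_left (C.approx_add_le_left _ _ g)).inner tendsto_const_nhds
  have h2 : Tendsto (fun f => inner ℂ v (C.op f v')) (C.approx (C.meas v + C.meas v') g)
      (𝓝 (inner ℂ v w')) :=
    tendsto_const_nhds.inner (h'.tendsto.mono_left (C.approx_add_le_right _ _ g))
  simp only [C.inner_op_left] at h1
  exact tendsto_nhds_unique h1 h2

theorem IsValue.inner_eq (h : C.IsValue v g w) :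
    inner ℂ v w = ((∫ x, g x ∂(C.meas v) : ℝ) : ℂ) := by
  have := C.approx_neBot h.memLp
  have h1 := (tendsto_const_nhds (x := v)).inner (𝕜 := ℂ) h.tendsto
  simp only [C.inner_op] at h1
  refine tendsto_nhds_unique h1 ((Complex.continuous_ofReal.tendsto _).comp ?_)
  have hsub f := (h.memLp.sub (C.memLp_sym f _)).aestronglyMeasurable
  refine tendsto_integral_of_L1' g (h.memLp.integrable (by norm_num)).aestronglyMeasurable
    (.of_forall fun f => (C.memLp_sym f _).integrable (by norm_num)) ?_
  have h2 := ENNReal.Tendsto.mul_const (C.tendsto_approx (C.meas v) g)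
    (b := C.meas v Set.univ ^ (1 / (1 : ℝ≥0∞).toReal - 1 / (2 : ℝ≥0∞).toReal))
    (.inr (ENNReal.rpow_ne_top_of_nonneg (by norm_num) (measure_ne_top _ _)))
  refine tendsto_of_tendsto_of_tendsto_of_le_of_le tendsto_const_nhds
    (by rwa [zero_mul] at h2) (fun _ => zero_le) fun f => ?_
  rw [eLpNorm_sub_comm]
  exact eLpNorm_le_eLpNorm_mul_rpow_measure_univ (by norm_num) (hsub f)

theorem IsValue.meas_eq (h : C.IsValue v g w) :
    C.meas w = (C.meas v).withDensity fun x => ‖g x‖ₑ ^ 2 := by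
  have := isFiniteMeasure_withDensity_enorm_sq h.memLp
  refine C.measure_eq_of_eLpNorm_sym_eq fun f => ?_
  rw [eLpNorm_two_withDensity_enorm_sq h.memLp.aestronglyMeasurable, ← C.enorm_op,
    (h.op_mul f).enorm]

theorem IsValue.eLpNorm_eq (h : C.IsValue v g w) (g' : α → ℝ) :
    eLpNorm g' 2 (C.meas w) = eLpNorm (g' * g) 2 (C.meas v) := by
  rw [h.meas_eq, eLpNorm_two_withDensity_enorm_sq h.memLp.aestronglyMeasurable]

theorem IsValue.comp {z : H} (h : C.IsValue v g w) (h' : C.IsValue w g' z)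
    (hg' : Measurable g') : C.IsValue v (g' * g) z := by
  have := C.approx_neBot h'.memLp
  refine .of_tendsto_isValue (l := C.approx (C.meas w) g')
    ⟨hg'.aestronglyMeasurable.mul h.memLp.aestronglyMeasurable, ?_⟩ h.op_mul ?_ h'.tendsto
  · rw [← h.eLpNorm_eq]
    exact h'.memLp.eLpNorm_lt_top
  · simpa only [← sub_mul, ← h.eLpNorm_eq] using C.tendsto_approx (C.meas w) g'

end L2Calculus

end L2Calculus

section Projections

open Filter Topology
open scoped ENNReal

namespace L2Calculus

variable {H : Type*} [NormedAddCommGroup H] [InnerProductSpace ℂ H] [CompleteSpace H]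
  {α : Type*} [MeasurableSpace α] {V : Type*} [Ring V] [Algebra ℝ V] (C : L2Calculus H α V)
  {S T : Set α}

open Classical in
/-- The spectral projection of a measurable set, that is, the value of the calculus at its
indicator function. On the other sets it is `0`. -/
noncomputable def proj (S : Set α) : H →L[ℂ] H :=
  if hS : MeasurableSet S then
    have h v := C.exists_isValue v (memLp_indicator_one (ν := C.meas v) hS)
    LinearMap.mkContinuous
      { toFun := fun v => (h v).choose
        map_add' := fun v v' => (h (v + v')).choose_spec.unique
          ((h v).choose_spec.add_vector (h v').choose_spec (memLp_indicator_one hS))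
        map_smul' := fun c v => (h (c • v)).choose_spec.unique
          ((h v).choose_spec.smul_vector c (memLp_indicator_one hS)) } 1
      fun v => by
        rw [one_mul, ← enorm_le_iff_norm_le]
        exact ((h v).choose_spec.enorm.trans_le (eLpNorm_indicator_le _)).trans_eq
          (C.isValue_one v).enorm.symm
  else 0

theorem isValue_proj (hS : MeasurableSet S) (v : H) :
    C.IsValue v (S.indicator 1) (C.proj S v) := by
  rw [proj, dif_pos hS]
  exact (C.exists_isValue v (memLp_indicator_one hS)).choose_spec

theorem proj_empty : C.proj ∅ = 0 := by
  ext v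
  have h := C.isValue_proj .empty v
  rw [Set.indicator_empty] at h
  exact h.unique (C.isValue_zero v)

theorem proj_univ : C.proj Set.univ = 1 := by
  ext v
  have h := C.isValue_proj .univ v
  rw [Set.indicator_univ] at h
  exact h.unique (C.isValue_one v)

theorem proj_inter (hS : MeasurableSet S) (hT : MeasurableSet T) :
    C.proj (S ∩ T) = C.proj S * C.proj T := by
  ext v
  have h := (C.isValue_proj hT v).comp (C.isValue_proj hS _) (measurable_one.indicator hS)
  rw [← Set.inter_indicator_one] at h
  exact (C.isValue_proj (hS.inter hT) v).unique h

theorem isStarProjection_proj (hS : MeasurableSet S) : IsStarProjection (C.proj S) := by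
  refine ⟨?_, ?_⟩
  · rw [IsIdempotentElem, ← C.proj_inter hS hS, Set.inter_self]
  · rw [ContinuousLinearMap.isSelfAdjoint_iff_isSymmetric]
    exact fun v w => (C.isValue_proj hS v).inner_comm (C.isValue_proj hS w)

theorem enorm_proj_iUnion_sub_sum {S : ℕ → Set α} (hS : ∀ i, MeasurableSet (S i))
    (hd : Pairwise (Function.onFun Disjoint S)) (v : H) (s : Finset ℕ) :
    ‖C.proj (⋃ i, S i) v - ∑ i ∈ s, C.proj (S i) v‖ₑ =
      C.meas v ((⋃ i, S i) \ ⋃ i ∈ s, S i) ^ (1 / 2 : ℝ) := by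
  have hsum : ∑ i ∈ s, (S i).indicator (1 : α → ℝ) = (⋃ i ∈ s, S i).indicator 1 := by
    ext x
    rw [Finset.indicator_biUnion_apply _ _ fun i _ j _ hij => hd hij, Finset.sum_apply]
  rw [((C.isValue_proj (.iUnion hS) v).sub (.sum fun i _ => C.isValue_proj (hS i) v)).enorm,
    hsum, ← Set.indicator_sdiff (Set.iUnion₂_subset_iUnion _ _), eLpNorm_two_indicator_one
      ((MeasurableSet.iUnion hS).diff (s.measurableSet_biUnion fun i _ => hS i))]

theorem hasSum_proj {S : ℕ → Set α} (hS : ∀ i, MeasurableSet (S i))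
    (hd : Pairwise (Function.onFun Disjoint S)) (v : H) :
    HasSum (fun i => C.proj (S i) v) (C.proj (⋃ i, S i) v) := by
  have hempty : ⋂ s : Finset ℕ, (⋃ i, S i) \ ⋃ i ∈ s, S i = ∅ := by
    refine Set.eq_empty_of_forall_notMem fun x hx => ?_
    obtain ⟨i, hi⟩ := Set.mem_iUnion.1 (Set.mem_iInter.1 hx ∅).1
    exact (Set.mem_iInter.1 hx {i}).2 (by simpa using hi)
  have h0 : Tendsto (fun s : Finset ℕ => C.meas v ((⋃ i, S i) \ ⋃ i ∈ s, S i)) atTop (𝓝 0) := by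
    rw [← measure_empty (μ := C.meas v), ← hempty]
    refine tendsto_measure_iInter_atTop (fun s => ((MeasurableSet.iUnion hS).diff
      (s.measurableSet_biUnion fun i _ => hS i)).nullMeasurableSet) (fun s t hst => ?_)
      ⟨∅, measure_ne_top _ _⟩
    exact Set.sdiff_subset_sdiff_right (Set.biUnion_subset_biUnion_left hst)
  rw [HasSum, SummationFilter.unconditional_filter, tendsto_iff_edist_tendsto_0]
  simp only [edist_comm, edist_eq_enorm_sub (C.proj _ v), C.enorm_proj_iUnion_sub_sum hS hd]
  simpa using h0.ennrpow_const (1 / 2)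

/-- The projection-valued measure of a calculus, transported to `ℝ` by a measurable function. -/
noncomputable def projectionValuedMeasure {b : α → ℝ} (hb : Measurable b) :
    ProjectionValuedMeasure H where
  proj S := C.proj (b ⁻¹' S)
  isStarProjection S hS := C.isStarProjection_proj (hb hS)
  proj_empty := by rw [Set.preimage_empty, C.proj_empty]
  proj_univ := by rw [Set.preimage_univ, C.proj_univ]
  proj_inter S T hS hT := C.proj_inter (hb hS) (hb hT)
  hasSum_proj S hS hd v := by
    rw [Set.preimage_iUnion]
    exact C.hasSum_proj (fun i => hb (hS i)) (fun i j h => (hd h).preimage b) v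

end L2Calculus

namespace ProjectionValuedMeasure

variable {H : Type*} [NormedAddCommGroup H] [InnerProductSpace ℂ H] [CompleteSpace H]
  (E : ProjectionValuedMeasure H) {S T : Set ℝ}

theorem scalarMeasure_apply (v : H) (hS : MeasurableSet S) :
    E.scalarMeasure v S = ENNReal.ofReal (inner ℂ v (E.proj S v)).re :=
  Measure.ofMeasurable_apply S hS

instance (v : H) : IsFiniteMeasure (E.scalarMeasure v) :=
  ⟨by rw [E.scalarMeasure_apply v .univ]; exact ENNReal.ofReal_lt_top⟩

theorem inner_proj (hS : MeasurableSet S) (v : H) :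
    inner ℂ v (E.proj S v) = (((E.scalarMeasure v).real S : ℝ) : ℂ) := by
  have hsymm := ContinuousLinearMap.isSelfAdjoint_iff_isSymmetric.1
    (E.isStarProjection S hS).isSelfAdjoint
  rw [measureReal_def, E.scalarMeasure_apply v hS, ENNReal.toReal_ofReal (E.re_inner_nonneg hS v)]
  exact Complex.ext rfl (hsymm.im_inner_self_apply v)

theorem proj_union (hS : MeasurableSet S) (hT : MeasurableSet T) (hd : Disjoint S T) :
    E.proj (S ∪ T) = E.proj S + E.proj T := by
  refine ContinuousLinearMap.coe_injective <| ext_inner_map _ _ |>.1 fun v => ?_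
  rw [← inner_conj_symm]
  nth_rw 2 [← inner_conj_symm]
  congr 1
  simp only [ContinuousLinearMap.coe_coe, add_apply, inner_add_right]
  rw [E.inner_proj (hS.union hT), E.inner_proj hS, E.inner_proj hT, measureReal_union hd hT]
  push_cast
  rfl

/-- The integral `∑ c E(f = c)` of a simple function against a projection-valued measure. -/
noncomputable def simpleIntegral (f : SimpleFunc ℝ ℝ) : H →L[ℂ] H :=
  f.setToSimpleFunc fun S => ContinuousLinearMap.toSpanSingleton ℝ (E.proj S)

open Classical in
theorem simpleIntegral_indicator (hS : MeasurableSet S) (c : ℝ) :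
    E.simpleIntegral (.piecewise S hS (.const ℝ c) (.const ℝ 0)) = c • E.proj S := by
  rw [simpleIntegral, SimpleFunc.setToSimpleFunc_indicator _ _ hS]
  · simp
  · simp [E.proj_empty]

theorem finMeasAdditive_toSpanSingleton_proj : FinMeasAdditive (0 : Measure ℝ) fun S =>
    ContinuousLinearMap.toSpanSingleton ℝ (E.proj S) := by
  intro S T hS hT _ _ hd
  simp only [E.proj_union hS hT hd, ContinuousLinearMap.toSpanSingleton_add]

theorem simpleIntegral_add (f g : SimpleFunc ℝ ℝ) :
    E.simpleIntegral (f + g) = E.simpleIntegral f + E.simpleIntegral g :=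
  SimpleFunc.setToSimpleFunc_add _ E.finMeasAdditive_toSpanSingleton_proj
    integrable_zero_measure integrable_zero_measure

theorem simpleIntegral_mul (f g : SimpleFunc ℝ ℝ) :
    E.simpleIntegral (f * g) = E.simpleIntegral f * E.simpleIntegral g := by
  classical
  induction f using SimpleFunc.induction with
  | add _ hf hf' => rw [add_mul, simpleIntegral_add, hf, hf', simpleIntegral_add, add_mul]
  | @const c S hS =>
    induction g using SimpleFunc.induction with
    | add _ hg hg' => rw [mul_add, simpleIntegral_add, hg, hg', simpleIntegral_add, mul_add]
    | @const d T hT =>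
      have hmul : (SimpleFunc.piecewise S hS (.const ℝ c) (.const ℝ 0) *
          SimpleFunc.piecewise T hT (.const ℝ d) (.const ℝ 0) : SimpleFunc ℝ ℝ) =
          .piecewise (S ∩ T) (hS.inter hT) (.const ℝ (c * d)) (.const ℝ 0) := by
        ext x
        by_cases hx : x ∈ S <;> by_cases hx' : x ∈ T <;> simp [hx, hx']
      rw [hmul, simpleIntegral_indicator, simpleIntegral_indicator, simpleIntegral_indicator,
        E.proj_inter _ _ hS hT, smul_mul_smul_comm]

theorem simpleIntegral_one : E.simpleIntegral 1 = 1 := by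
  classical
  have h : (1 : SimpleFunc ℝ ℝ) = .piecewise Set.univ .univ (.const ℝ 1) (.const ℝ 0) := by
    ext x
    simp
  rw [h, simpleIntegral_indicator, E.proj_univ, one_smul]

theorem inner_simpleIntegral (f : SimpleFunc ℝ ℝ) (v : H) :
    inner ℂ v (E.simpleIntegral f v) = ((∫ t, f t ∂(E.scalarMeasure v) : ℝ) : ℂ) := by
  classical
  induction f using SimpleFunc.induction with
  | @const c S hS =>
    have h : (SimpleFunc.piecewise S hS (.const ℝ c) (.const ℝ 0) : ℝ → ℝ) =
        S.indicator fun _ => c := by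
      ext t
      simp [Set.indicator, Set.piecewise]
    rw [simpleIntegral_indicator, h, integral_indicator_const _ hS, smul_apply,
      inner_smul_right_eq_smul, E.inner_proj hS]
    simp [mul_comm]
  | add _ hf hg =>
    rw [simpleIntegral_add, add_apply, inner_add_right, hf, hg, SimpleFunc.coe_add,
      integral_add' (SimpleFunc.integrable_of_isFiniteMeasure _)
        (SimpleFunc.integrable_of_isFiniteMeasure _)]
    push_cast
    rfl

/-- The integral of functions against a projection-valued measure `E`: the symbols are the simple
functions, and `IsValue v g w` means `w = (∫ g dE) v`. -/
noncomputable def calculus : L2Calculus H ℝ (SimpleFunc ℝ ℝ) where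
  sym :=
    { toFun := fun f => f
      map_one' := rfl
      map_mul' := fun _ _ => rfl
      map_zero' := rfl
      map_add' := fun _ _ => rfl
      commutes' := fun _ => rfl }
  op := .ofLinearMap
    { toFun := E.simpleIntegral
      map_add' := E.simpleIntegral_add
      map_smul' := fun c _ => SimpleFunc.setToSimpleFunc_smul_real _
        E.finMeasAdditive_toSpanSingleton_proj c integrable_zero_measure }
    E.simpleIntegral_one E.simpleIntegral_mul
  meas := E.scalarMeasure
  isFiniteMeasure_meas := inferInstance
  measurable_sym f := f.measurable
  exists_bound_sym f := f.exists_forall_norm_le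
  inner_op := E.inner_simpleIntegral
  exists_approx _ _ _ hg _ hε :=
    (hg.exists_simpleFunc_eLpNorm_sub_lt (by norm_num) hε).imp fun _ hf => hf.1.le

end ProjectionValuedMeasure

theorem L2Calculus.scalarMeasure_projectionValuedMeasure {H α V : Type*} [NormedAddCommGroup H]
    [InnerProductSpace ℂ H] [CompleteSpace H] [MeasurableSpace α] [Ring V] [Algebra ℝ V]
    (C : L2Calculus H α V) {b : α → ℝ} (hb : Measurable b) (v : H) :
    (C.projectionValuedMeasure hb).scalarMeasure v = (C.meas v).map b := by
  ext S hS
  rw [ProjectionValuedMeasure.scalarMeasure_apply _ _ hS, Measure.map_apply hb hS,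
    projectionValuedMeasure, (C.isValue_proj (hb hS) v).inner_eq, integral_indicator_one (hb hS)]
  simp

end Projections

section ContinuousFunctionalCalculus

variable {H : Type*} [NormedAddCommGroup H] [InnerProductSpace ℂ H] [CompleteSpace H]
  {R : H →L[ℂ] H} (hR : IsSelfAdjoint R)

include hR in
theorem cfcHom_isSymmetric (f : C(spectrum ℝ R, ℝ)) :
    (cfcHom (R := ℝ) hR f : H →ₗ[ℂ] H).IsSymmetric :=
  ContinuousLinearMap.isSelfAdjoint_iff_isSymmetric.1 (isSelfAdjoint_map (cfcHom hR) f)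

/-- The positive functional `f ↦ ⟨v, f(R) v⟩`. The spectrum of `R` being compact, the functions of
compact support, to which the Riesz–Markov–Kakutani theorem applies, are all continuous ones. -/
noncomputable def cfcFunctional (v : H) :
    CompactlySupportedContinuousMap (spectrum ℝ R) ℝ →ₚ[ℝ] ℝ :=
  PositiveLinearMap.mk₀
    { toFun := fun f => (inner ℂ v (cfcHom (R := ℝ) hR f v)).re
      map_add' := fun f g => by
        have : ((f + g : CompactlySupportedContinuousMap (spectrum ℝ R) ℝ) :
          C(spectrum ℝ R, ℝ)) = f + g := rfl
        rw [this, map_add, add_apply, inner_add_right, Complex.add_re]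
      map_smul' := fun c f => by
        have : ((c • f : CompactlySupportedContinuousMap (spectrum ℝ R) ℝ) :
          C(spectrum ℝ R, ℝ)) = c • (f : C(spectrum ℝ R, ℝ)) := rfl
        rw [this, map_smul, smul_apply, inner_smul_right_eq_smul, Complex.smul_re,
          RingHom.id_apply] }
    fun f hf => by
      let g : C(spectrum ℝ R, ℝ) := ⟨fun x => √(f x), by fun_prop⟩
      have hg : (f : C(spectrum ℝ R, ℝ)) = g * g := by
        ext x
        exact (Real.mul_self_sqrt (hf x)).symm
      have hinner : inner ℂ v (cfcHom (R := ℝ) hR f v) =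
          inner ℂ (cfcHom (R := ℝ) hR g v) (cfcHom (R := ℝ) hR g v) := by
        rw [hg, map_mul, mul_apply_eq_comp]
        exact (cfcHom_isSymmetric hR g v _).symm
      change 0 ≤ (inner ℂ v (cfcHom (R := ℝ) hR f v)).re
      rw [hinner]
      exact inner_self_nonneg (𝕜 := ℂ)

/-- The continuous functional calculus of a bounded self-adjoint operator. -/
noncomputable def cfcCalculus : L2Calculus H (spectrum ℝ R) C(spectrum ℝ R, ℝ) where
  sym := ContinuousMap.coeFnAlgHom ℝ
  op := (cfcHom (R := ℝ) hR).toAlgHom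
  meas v := RealRMK.rieszMeasure (cfcFunctional hR v)
  isFiniteMeasure_meas v := inferInstance
  measurable_sym f := f.continuous.measurable
  exists_bound_sym f := ⟨‖f‖, f.norm_coe_le_norm⟩
  inner_op f v := Complex.ext
    (RealRMK.integral_rieszMeasure (cfcFunctional hR v)
      (CompactlySupportedContinuousMap.continuousMapEquiv f)).symm
    ((cfcHom_isSymmetric hR f).im_inner_self_apply v)
  exists_approx ν _ g hg ε hε := by
    obtain ⟨f, hf, -⟩ := hg.exists_boundedContinuous_eLpNorm_sub_le (by norm_num) hε
    exact ⟨f.toContinuousMap, hf⟩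

end ContinuousFunctionalCalculus

/-! ### The spectral theorem -/

section Resolvent

variable {H : Type*} [NormedAddCommGroup H] [InnerProductSpace ℂ H]

theorem IsNonnegativeOperator.topologicalClosure {Γ : Submodule ℂ (H × H)}
    (h : IsNonnegativeOperator Γ) : IsNonnegativeOperator Γ.topologicalClosure := by
  have hcont : Continuous fun p : H × H => inner ℂ p.1 p.2 := by fun_prop
  have hclosed : IsClosed {p : H × H | 0 ≤ (inner ℂ p.1 p.2).re ∧ (inner ℂ p.1 p.2).im = 0} :=
    (isClosed_le continuous_const (Complex.continuous_re.comp hcont)).inter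
      (isClosed_eq (Complex.continuous_im.comp hcont) continuous_const)
  exact fun p hp => closure_minimal h hclosed hp

theorem IsNonnegativeOperator.norm_le_norm_add {Γ : Submodule ℂ (H × H)}
    (h : IsNonnegativeOperator Γ) {p : H × H} (hp : p ∈ Γ) : ‖p‖ ≤ ‖p.1 + p.2‖ := by
  have hsq : ‖p.1 + p.2‖ ^ 2 = ‖p.1‖ ^ 2 + 2 * (inner ℂ p.1 p.2).re + ‖p.2‖ ^ 2 :=
    norm_add_sq (𝕜 := ℂ) p.1 p.2
  have hre := (h p hp).1
  refine max_le (abs_le_of_sq_le_sq' ?_ (norm_nonneg _)).2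
    (abs_le_of_sq_le_sq' ?_ (norm_nonneg _)).2
  · linarith [sq_nonneg ‖p.2‖]
  · linarith [sq_nonneg ‖p.1‖]

variable [CompleteSpace H] {A : H →ₗ.[ℂ] H}

theorem mem_graph_iff_of_isSelfAdjoint (hA : IsSelfAdjoint A) {p : H × H} :
    p ∈ A.graph ↔ ∀ q ∈ A.graph, inner ℂ q.2 p.1 = inner ℂ q.1 p.2 := by
  conv_lhs => rw [← LinearPMap.isSelfAdjoint_def.1 hA,
    LinearPMap.adjoint_graph_eq_graph_adjoint hA.dense_domain, Submodule.mem_adjoint_iff]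
  simp only [sub_eq_zero, Prod.forall]

theorem graph_onePlus_bijective (hA : IsSelfAdjoint A) (hpos : IsNonnegativeOperator A.graph) :
    Function.Bijective fun p : A.graph => p.1.1 + p.1.2 := by
  let F : A.graph →L[ℂ] H :=
    ((ContinuousLinearMap.id ℂ H).coprod (.id ℂ H)).comp A.graph.subtypeL
  have hF : AntilipschitzWith 1 F :=
    F.antilipschitz_of_bound fun p => by
      rw [NNReal.coe_one, one_mul]
      exact hpos.norm_le_norm_add p.2
  have : CompleteSpace A.graph := hA.isClosed.completeSpace_coe
  have : CompleteSpace F.range :=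
    (hF.isClosed_range F.uniformContinuous).completeSpace_coe
  suffices F.rangeᗮ = ⊥ from
    ⟨hF.injective, LinearMap.range_eq_top.1 (Submodule.orthogonal_eq_bot_iff.1 this)⟩
  rw [Submodule.eq_bot_iff]
  intro z hz
  have hmem : (z, -z) ∈ A.graph := by
    rw [mem_graph_iff_of_isSelfAdjoint hA]
    intro q hq
    have h : inner ℂ (q.1 + q.2) z = 0 := (Submodule.mem_orthogonal _ _).1 hz _ ⟨⟨q, hq⟩, rfl⟩
    rw [inner_neg_right, eq_neg_iff_add_eq_zero, add_comm, ← inner_add_left, h]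
  simpa using (norm_fst_le (z, -z)).trans (hpos.norm_le_norm_add hmem)

theorem exists_resolvent (hA : IsSelfAdjoint A) (hpos : IsNonnegativeOperator A.graph) :
    ∃ R : H →L[ℂ] H, IsSelfAdjoint R ∧ ∀ v w, R w = v ↔ (v, w - v) ∈ A.graph := by
  let e := LinearEquiv.ofBijective
    ((LinearMap.id.coprod .id : H × H →ₗ[ℂ] H) ∘ₗ A.graph.subtype)
    (graph_onePlus_bijective hA hpos)
  have he w : (e.symm w).1.1 + (e.symm w).1.2 = w := e.apply_symm_apply w
  let R : H →L[ℂ] H :=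
    (LinearMap.fst ℂ H H ∘ₗ A.graph.subtype ∘ₗ e.symm.toLinearMap).mkContinuous 1 fun w => by
      have h := (norm_fst_le _).trans (hpos.norm_le_norm_add (e.symm w).2)
      rw [he] at h
      simpa using h
  have hmem w : (R w, w - R w) ∈ A.graph := by
    have h : (R w, w - R w) = (e.symm w).1 :=
      Prod.ext rfl (sub_eq_of_eq_add' (he w).symm)
    exact h ▸ (e.symm w).2
  refine ⟨R, ?_, fun v w => ⟨fun h => h ▸ hmem w, fun h => ?_⟩⟩
  · rw [ContinuousLinearMap.isSelfAdjoint_iff_isSymmetric]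
    intro w w'
    have h := (mem_graph_iff_of_isSelfAdjoint hA).1 (hmem w') _ (hmem w)
    simpa [inner_sub_left, inner_sub_right, eq_comm] using h
  · have hw : e ⟨(v, w - v), h⟩ = w := add_sub_cancel v w
    have hR : R (e ⟨(v, w - v), h⟩) = v := congrArg (fun p => p.1.1) (e.symm_apply_apply _)
    rwa [hw] at hR

end Resolvent

section SpectralTheorem

variable {H : Type*} [NormedAddCommGroup H] [InnerProductSpace ℂ H] [CompleteSpace H]

section Bounded

variable {R : H →L[ℂ] H} (hR : IsSelfAdjoint R)

theorem isValue_cfcCalculus_id (v : H) : (cfcCalculus hR).IsValue v (↑) (R v) := by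
  have h := (cfcCalculus hR).isValue_op (.restrict (spectrum ℝ R) (.id ℝ)) v
  have hop : (cfcCalculus hR).op (.restrict (spectrum ℝ R) (.id ℝ)) = R := cfcHom_id hR
  rwa [hop] at h

theorem ae_ne_zero_meas_cfcCalculus (hinj : Function.Injective R) (v : H) :
    ∀ᵐ t : spectrum ℝ R ∂((cfcCalculus hR).meas v), (t : ℝ) ≠ 0 := by
  have hS : MeasurableSet {t : spectrum ℝ R | (t : ℝ) = 0} :=
    measurableSet_eq_fun measurable_subtype_coe measurable_const
  let w := (cfcCalculus hR).proj {t : spectrum ℝ R | (t : ℝ) = 0} v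
  have hw : (cfcCalculus hR).IsValue v _ w := (cfcCalculus hR).isValue_proj hS v
  have hmul : (fun t : spectrum ℝ R => (t : ℝ)) *
      Set.indicator {t : spectrum ℝ R | (t : ℝ) = 0} 1 = 0 := by
    ext t
    by_cases ht : (t : ℝ) = 0 <;> simp [ht]
  have hRw := hw.comp (isValue_cfcCalculus_id hR w) measurable_subtype_coe
  rw [hmul] at hRw
  have hw0 : w = 0 := hinj ((hRw.unique ((cfcCalculus hR).isValue_zero v)).trans (map_zero R).symm)
  have h := hw.enorm
  rw [hw0, enorm_zero, eLpNorm_two_indicator_one hS, eq_comm] at h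
  rw [ae_iff]
  simpa using h

theorem isValue_cfcCalculus_inv_iff (hinj : Function.Injective R) {v w : H} :
    (cfcCalculus hR).IsValue v (fun t => (t : ℝ)⁻¹) w ↔ R w = v := by
  have hone (v : H) : (fun t : spectrum ℝ R => (t : ℝ)⁻¹) * (↑) =ᵐ[(cfcCalculus hR).meas v] 1 := by
    filter_upwards [ae_ne_zero_meas_cfcCalculus hR hinj v] with t ht using inv_mul_cancel₀ ht
  have hmeas : Measurable fun t : spectrum ℝ R => (t : ℝ)⁻¹ := measurable_subtype_coe.inv
  constructor
  · intro h
    have h' := h.comp (isValue_cfcCalculus_id hR w) measurable_subtype_coe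
    rw [mul_comm] at h'
    exact (h'.congr (hone v)).unique ((cfcCalculus hR).isValue_one v)
  · rintro rfl
    have h := isValue_cfcCalculus_id hR w
    have hL : MemLp (fun t : spectrum ℝ R => (t : ℝ)⁻¹) 2 ((cfcCalculus hR).meas (R w)) := by
      refine ⟨hmeas.aestronglyMeasurable, ?_⟩
      rw [h.eLpNorm_eq, eLpNorm_congr_ae (hone w)]
      exact ((cfcCalculus hR).isValue_one w).memLp.eLpNorm_lt_top
    obtain ⟨z, hz⟩ := (cfcCalculus hR).exists_isValue (R w) hL
    rwa [((h.comp hz hmeas).congr (hone w)).unique ((cfcCalculus hR).isValue_one w)] at hz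

end Bounded

theorem L2Calculus.isSpectralMeasureOf {α V : Type*} [MeasurableSpace α] [Ring V] [Algebra ℝ V]
    (C : L2Calculus H α V) {A : H →ₗ.[ℂ] H} {b : α → ℝ} (hb : Measurable b)
    (h : ∀ v w, (v, w) ∈ A.graph ↔ C.IsValue v b w) :
    (C.projectionValuedMeasure hb).IsSpectralMeasureOf A := by
  refine ⟨fun v => ?_, fun v => ?_⟩
  · rw [C.scalarMeasure_projectionValuedMeasure hb, lintegral_map (by fun_prop) hb,
      ← memLp_two_iff_lintegral_lt_top hb.aestronglyMeasurable, LinearPMap.mem_domain_iff]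
    simp only [h]
    exact ⟨fun ⟨w, hw⟩ => hw.memLp, C.exists_isValue v⟩
  · rw [C.scalarMeasure_projectionValuedMeasure hb, integral_map hb.aemeasurable (by fun_prop)]
    exact ((h v (A v)).1 (A.mem_graph v)).inner_eq

theorem exists_isSpectralMeasureOf {A : H →ₗ.[ℂ] H} (hA : IsSelfAdjoint A)
    (hpos : IsNonnegativeOperator A.graph) :
    ∃ E : ProjectionValuedMeasure H, E.IsSpectralMeasureOf A := by
  obtain ⟨R, hR, hRA⟩ := exists_resolvent hA hpos
  have hinj : Function.Injective R := fun w w' h => by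
    have h' := A.graph.sub_mem ((hRA _ w).1 rfl) ((hRA _ w').1 h.symm)
    rw [Prod.mk_sub_mk, sub_self, sub_sub_sub_cancel_right] at h'
    exact sub_eq_zero.1 (A.graph_fst_eq_zero_snd h' rfl)
  have hb : Measurable ((fun t : spectrum ℝ R => (t : ℝ)⁻¹) - 1) :=
    measurable_subtype_coe.inv.sub measurable_one
  refine ⟨_, (cfcCalculus hR).isSpectralMeasureOf hb fun v w => ?_⟩
  have hone := (cfcCalculus hR).isValue_one v
  rw [← add_sub_cancel_left v w, ← hRA, ← isValue_cfcCalculus_inv_iff hR hinj]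
  exact ⟨fun h => h.sub hone, fun h => by simpa using hone.add h⟩

end SpectralTheorem

/-! ### Gevrey vectors -/

section Moments

variable {H : Type*} [NormedAddCommGroup H] [InnerProductSpace ℂ H]

theorem eq_zero_of_forall_inner_self_eq_zero {K : Submodule ℂ H} (hK : Dense (K : Set H))
    (T : K →ₗ[ℂ] H) (h : ∀ v : K, inner ℂ (v : H) (T v) = 0) : T = 0 := by
  have hsesq (u v : K) : inner ℂ (u : H) (T v) = 0 := by
    have h1 := h (u + v)
    have h2 := h (u + Complex.I • v)
    simp only [map_add, map_smul, Submodule.coe_add, Submodule.coe_smul, inner_add_left,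
      inner_add_right, inner_smul_left, inner_smul_right, h, Complex.conj_I] at h1 h2
    linear_combination (h1 - Complex.I * h2) / 2 +
      (inner ℂ (u : H) (T v) - inner ℂ (v : H) (T u)) / 2 * Complex.I_sq
  ext v
  exact hK.eq_zero_of_inner_right (𝕜 := ℂ) fun u hu => hsesq ⟨u, hu⟩ v

variable [CompleteSpace H] {A : H →ₗ.[ℂ] H} {E : ProjectionValuedMeasure H} {v w : H}

namespace ProjectionValuedMeasure

theorem IsSpectralMeasureOf.mem_domain_iff (hE : E.IsSpectralMeasureOf A) :
    v ∈ A.domain ↔ MemLp id 2 (E.calculus.meas v) :=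
  (hE.1 v).trans (memLp_two_iff_lintegral_lt_top measurable_id.aestronglyMeasurable).symm

theorem IsSpectralMeasureOf.isValue_apply (hE : E.IsSpectralMeasureOf A)
    (hA : Dense (A.domain : Set H)) (v : A.domain) : E.calculus.IsValue v id (A v) := by
  have hmem (v : A.domain) : MemLp id 2 (E.calculus.meas v) := hE.mem_domain_iff.1 v.2
  choose B hB using fun v : A.domain => E.calculus.exists_isValue (v : H) (hmem v)
  let B' : A.domain →ₗ[ℂ] H :=
    { toFun := B
      map_add' := fun v w => (hB (v + w)).unique ((hB v).add_vector (hB w) (hmem (v + w)))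
      map_smul' := fun c v => (hB (c • v)).unique ((hB v).smul_vector c (hmem (c • v))) }
  have hAB : A.toFun - B' = 0 := eq_zero_of_forall_inner_self_eq_zero hA _ fun v => by
    rw [LinearMap.sub_apply, inner_sub_right, sub_eq_zero]
    exact (hE.2 v).trans (hB v).inner_eq.symm
  have hv : A v = B v := congrArg (· v) (sub_eq_zero.1 hAB)
  exact hv ▸ hB v

theorem IsSpectralMeasureOf.mem_graph_iff (hE : E.IsSpectralMeasureOf A)
    (hA : Dense (A.domain : Set H)) : (v, w) ∈ A.graph ↔ E.calculus.IsValue v id w := by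
  constructor
  · intro h
    obtain ⟨v', rfl, rfl⟩ := (LinearPMap.mem_graph_iff A).1 h
    exact hE.isValue_apply hA v'
  · intro h
    have hv := hE.mem_domain_iff.2 h.memLp
    exact h.unique (hE.isValue_apply hA ⟨v, hv⟩) ▸ A.mem_graph ⟨v, hv⟩

theorem IsSpectralMeasureOf.ae_nonneg (hE : E.IsSpectralMeasureOf A)
    (hA : Dense (A.domain : Set H)) (hpos : IsNonnegativeOperator A.graph) (v : H) :
    ∀ᵐ t ∂(E.scalarMeasure v), 0 ≤ t := by
  suffices h : ∀ n : ℕ, E.scalarMeasure v (Set.Ico (-n : ℝ) 0) = 0 by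
    refine ae_iff.2 (measure_mono_null (fun t ht => ?_) (measure_iUnion_null h))
    obtain ⟨n, hn⟩ := exists_nat_ge (-t)
    exact Set.mem_iUnion.2 ⟨n, neg_le.1 hn, not_le.1 ht⟩
  intro n
  set S := Set.Ico (-n : ℝ) 0
  have hS : MeasurableSet S := measurableSet_Ico
  have hw := E.calculus.isValue_proj hS v
  have hmeas : E.calculus.meas (E.calculus.proj S v) = (E.scalarMeasure v).restrict S := by
    have hind : (fun t => ‖S.indicator (1 : ℝ → ℝ) t‖ₑ ^ 2) = S.indicator 1 := by
      ext t
      by_cases ht : t ∈ S <;> simp [ht]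
    rw [hw.meas_eq, hind, withDensity_indicator_one hS]
    rfl
  have hmem : MemLp id 2 ((E.scalarMeasure v).restrict S) := by
    refine .of_bound measurable_id.aestronglyMeasurable n ?_
    filter_upwards [ae_restrict_mem hS] with t ht
    exact abs_le.2 ⟨ht.1, ht.2.le.trans n.cast_nonneg⟩
  obtain ⟨z, hz⟩ := E.calculus.exists_isValue _ (hmeas ▸ hmem)
  have hint : 0 ≤ ∫ t in S, t ∂(E.scalarMeasure v) := by
    have h := (hpos _ ((hE.mem_graph_iff hA).2 hz)).1
    rwa [hz.inner_eq, hmeas] at h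
  have hneg : 0 ≤ᵐ[(E.scalarMeasure v).restrict S] fun t => -t := by
    filter_upwards [ae_restrict_mem hS] with t ht using neg_nonneg.2 ht.2.le
  have hsupp : Function.support (fun t : ℝ => -t) ∩ S = S :=
    Set.inter_eq_right.2 fun t ht => neg_ne_zero.2 ht.2.ne
  have h := setIntegral_pos_iff_support_of_nonneg_ae hneg (hmem.integrable (by norm_num)).neg
  rw [hsupp, integral_neg] at h
  exact not_ne_iff.1 fun h0 => (h.2 (pos_iff_ne_zero.2 h0)).not_ge (neg_nonpos.2 hint)

end ProjectionValuedMeasure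

/-- The sequence `x` consists of the vectors `x k = A ^ k v`; in particular these are defined. -/
def IsOrbit (A : H →ₗ.[ℂ] H) (v : H) (x : ℕ → H) : Prop :=
  x 0 = v ∧ ∀ k, (x k, x (k + 1)) ∈ A.graph

namespace ProjectionValuedMeasure

theorem IsSpectralMeasureOf.isValue_pow (hE : E.IsSpectralMeasureOf A)
    (hA : Dense (A.domain : Set H)) {x : ℕ → H} (hx : IsOrbit A v x) (k : ℕ) :
    E.calculus.IsValue v (fun t => t ^ k) (x k) := by
  induction k with
  | zero => simpa [hx.1, Pi.one_def] using E.calculus.isValue_one v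
  | succ k ih =>
    simp only [pow_succ']
    exact ih.comp ((hE.mem_graph_iff hA).1 (hx.2 k)) measurable_id

theorem IsSpectralMeasureOf.enorm_orbit_sq (hE : E.IsSpectralMeasureOf A)
    (hA : Dense (A.domain : Set H)) {x : ℕ → H} (hx : IsOrbit A v x) (k : ℕ) :
    ‖x k‖ₑ ^ 2 = ∫⁻ t, ENNReal.ofReal (t ^ (2 * k)) ∂(E.scalarMeasure v) := by
  simp only [(hE.isValue_pow hA hx k).enorm, eLpNorm_two_sq_eq_lintegral, pow_mul', calculus]

theorem IsSpectralMeasureOf.exists_isOrbit (hE : E.IsSpectralMeasureOf A)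
    (hA : Dense (A.domain : Set H))
    (h : ∀ k : ℕ, ∫⁻ t, ENNReal.ofReal (t ^ (2 * k)) ∂(E.scalarMeasure v) < ⊤) :
    ∃ x, IsOrbit A v x := by
  have hmem (k : ℕ) : MemLp (fun t => t ^ k) 2 (E.calculus.meas v) := by
    rw [memLp_two_iff_lintegral_lt_top (by fun_prop)]
    simp only [← pow_mul']
    exact h k
  choose x hx using fun k => E.calculus.exists_isValue v (hmem k)
  refine ⟨x, (hx 0).unique (by simpa [Pi.one_def] using E.calculus.isValue_one v), fun k => ?_⟩
  have hpow : (id * fun t : ℝ => t ^ k) = fun t => t ^ (k + 1) := by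
    ext t
    exact (pow_succ' t k).symm
  have hid : MemLp id 2 (E.calculus.meas (x k)) := by
    refine ⟨measurable_id.aestronglyMeasurable, ?_⟩
    rw [(hx k).eLpNorm_eq, hpow]
    exact (hmem (k + 1)).eLpNorm_lt_top
  obtain ⟨z, hz⟩ := E.calculus.exists_isValue (x k) hid
  have hz' := (hx k).comp hz measurable_id
  rw [hpow] at hz'
  exact (hE.mem_graph_iff hA).2 ((hx (k + 1)).unique hz' ▸ hz)

end ProjectionValuedMeasure

end Moments

section Gevrey

theorem pow_le_factorial_rpow_mul_exp {q D t : ℝ} (hq : 0 < q) (hD : 0 < D) (ht : 0 ≤ t) (m : ℕ) :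
    t ^ m ≤ ((q / D) ^ m * m.factorial) ^ q * Real.exp (D * t ^ (1 / q)) := by
  set y := D * t ^ (1 / q) / q with hy
  have hy0 : 0 ≤ y := by positivity
  have hexp : y ^ m ≤ m.factorial * Real.exp y :=
    (div_le_iff₀' (by positivity)).1 (Real.pow_div_factorial_le_exp y hy0 m)
  have hroot : t ^ (1 / q) = q / D * y := by
    rw [hy]
    field_simp
  calc t ^ m = ((t ^ (1 / q)) ^ m) ^ q := by
        rw [← Real.rpow_natCast_mul (by positivity), mul_comm,
          Real.rpow_mul_natCast (by positivity), ← Real.rpow_mul ht, one_div_mul_cancel hq.ne',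
          Real.rpow_one]
    _ ≤ ((q / D) ^ m * m.factorial * Real.exp y) ^ q := by
        rw [hroot, mul_pow, mul_assoc]
        gcongr
    _ = ((q / D) ^ m * m.factorial) ^ q * Real.exp (D * t ^ (1 / q)) := by
        rw [Real.mul_rpow (by positivity) (by positivity), ← Real.exp_mul, hy,
          div_mul_cancel₀ _ hq.ne']

theorem exists_exp_mul_factorial_rpow_le {q t : ℝ} (hq : 0 < q) (ht : 0 ≤ t) :
    ∃ k : ℕ, Real.exp (t ^ (1 / q)) * ((2 * k).factorial : ℝ) ^ q ≤
      Real.exp 2 * (Real.exp 1 * t) ^ (2 * k) := by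
  set y := t ^ (1 / q) with hy
  refine ⟨⌊y / 2⌋₊, ?_⟩
  set m := 2 * ⌊y / 2⌋₊ with hm
  have hmy : (m : ℝ) ≤ y := by
    rw [hm]
    push_cast
    linarith [Nat.floor_le (a := y / 2) (by positivity)]
  have hym : y ≤ 2 + m := by
    rw [hm]
    push_cast
    linarith [Nat.lt_floor_add_one (y / 2)]
  have hfact : (m.factorial : ℝ) ≤ y ^ m :=
    (Nat.cast_le.2 m.factorial_le_pow).trans (by push_cast; gcongr)
  calc Real.exp y * (m.factorial : ℝ) ^ q
      ≤ Real.exp (2 + m) * (y ^ m) ^ q := by gcongr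
    _ = Real.exp 2 * (Real.exp 1 * t) ^ m := by
        rw [Real.exp_add, mul_pow, ← Real.exp_nat_mul, mul_one, mul_assoc, hy,
          ← Real.rpow_natCast_mul (by positivity), mul_comm (m : ℝ),
          Real.rpow_mul_natCast (by positivity), ← Real.rpow_mul ht, one_div_mul_cancel hq.ne',
          Real.rpow_one]

variable {ν : Measure ℝ} {q : ℝ}

theorem lintegral_pow_le_mul_lintegral_exp {D : ℝ} (hν : ∀ᵐ t ∂ν, 0 ≤ t) (hq : 0 < q)
    (hD : 0 < D) (m : ℕ) :
    ∫⁻ t, ENNReal.ofReal (t ^ m) ∂ν ≤ ENNReal.ofReal (((q / D) ^ m * m.factorial) ^ q) *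
      ∫⁻ t, ENNReal.ofReal (Real.exp (D * t ^ (1 / q))) ∂ν := by
  rw [← lintegral_const_mul' _ _ ENNReal.ofReal_ne_top]
  refine lintegral_mono_ae ?_
  filter_upwards [hν] with t ht
  rw [← ENNReal.ofReal_mul (by positivity)]
  exact ENNReal.ofReal_le_ofReal (pow_le_factorial_rpow_mul_exp hq hD ht m)

theorem lintegral_exp_lt_top_of_lintegral_pow_le {b c : ℝ} (hν : ∀ᵐ t ∂ν, 0 ≤ t) (hq : 0 < q)
    (hb : 0 < b) (hc : 0 < c)
    (h : ∀ k : ℕ, ∫⁻ t, ENNReal.ofReal (t ^ (2 * k)) ∂ν ≤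
      ENNReal.ofReal (c * b ^ (2 * k) * ((2 * k).factorial : ℝ) ^ q)) :
    ∫⁻ t, ENNReal.ofReal (Real.exp ((t / (2 * Real.exp 1 * b)) ^ (1 / q))) ∂ν < ⊤ := by
  let w (k : ℕ) : ℝ := Real.exp 2 / ((2 * b) ^ (2 * k) * ((2 * k).factorial : ℝ) ^ q)
  have hw k : 0 ≤ w k := by positivity
  have hexp {t : ℝ} (ht : 0 ≤ t) :
      ENNReal.ofReal (Real.exp ((t / (2 * Real.exp 1 * b)) ^ (1 / q))) ≤
        ∑' k, ENNReal.ofReal (w k) * ENNReal.ofReal (t ^ (2 * k)) := by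
    obtain ⟨k, hk⟩ := exists_exp_mul_factorial_rpow_le hq
      (show 0 ≤ t / (2 * Real.exp 1 * b) by positivity)
    refine le_trans ?_ (ENNReal.le_tsum k)
    rw [← ENNReal.ofReal_mul (hw k)]
    refine ENNReal.ofReal_le_ofReal (((le_div_iff₀ (by positivity)).2 hk).trans_eq ?_)
    have : Real.exp 1 * (t / (2 * Real.exp 1 * b)) = t / (2 * b) := by field_simp
    rw [this, div_pow, div_mul_eq_mul_div, mul_div_assoc', div_div]
  have hterm k : ∫⁻ t, ENNReal.ofReal (w k) * ENNReal.ofReal (t ^ (2 * k)) ∂ν ≤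
      ENNReal.ofReal (Real.exp 2 * c * (1 / 4) ^ k) := by
    rw [lintegral_const_mul' _ _ ENNReal.ofReal_ne_top]
    refine (mul_le_mul_right (h k) _).trans_eq ?_
    rw [← ENNReal.ofReal_mul (hw k)]
    congr 1
    simp only [w, mul_pow, pow_mul (2 : ℝ)]
    field_simp
    norm_num [← mul_pow]
  have hsum : Summable fun k : ℕ => Real.exp 2 * c * (1 / 4 : ℝ) ^ k :=
    (summable_geometric_of_lt_one (by norm_num) (by norm_num)).mul_left _
  calc _ ≤ ∫⁻ t, ∑' k, ENNReal.ofReal (w k) * ENNReal.ofReal (t ^ (2 * k)) ∂ν :=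
        lintegral_mono_ae (hν.mono fun t => hexp)
    _ = ∑' k, ∫⁻ t, ENNReal.ofReal (w k) * ENNReal.ofReal (t ^ (2 * k)) ∂ν :=
        lintegral_tsum fun k => by fun_prop
    _ ≤ ∑' k, ENNReal.ofReal (Real.exp 2 * c * (1 / 4) ^ k) := ENNReal.tsum_le_tsum hterm
    _ < ⊤ := by
        rw [← ENNReal.ofReal_tsum_of_nonneg (fun k => by positivity) hsum]
        exact ENNReal.ofReal_lt_top

end Gevrey

section GevreyVector

theorem enorm_sq_le_ofReal_sq_iff {F : Type*} [SeminormedAddCommGroup F] {x : F} {r : ℝ}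
    (hr : 0 ≤ r) : ‖x‖ₑ ^ 2 ≤ ENNReal.ofReal (r ^ 2) ↔ ‖x‖ ≤ r := by
  rw [← ofReal_norm, ← ENNReal.ofReal_pow (norm_nonneg x),
    ENNReal.ofReal_le_ofReal_iff (by positivity), sq_le_sq₀ (norm_nonneg x) hr]

theorem rpow_two_mul_eq_sq {x : ℝ} (hx : 0 ≤ x) (s : ℝ) : x ^ (2 * s) = (x ^ s) ^ 2 := by
  rw [mul_comm, ← Nat.cast_two, Real.rpow_mul_natCast hx]

variable {H : Type*} [NormedAddCommGroup H] [InnerProductSpace ℂ H]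

/-- A Gevrey vector of order `s` of a second-order operator `A`: all powers `A ^ k v` are defined,
and they grow like the derivatives of order `2 * k` of a Gevrey function. -/
def IsGevreyVector [CompleteSpace H] (A : H →ₗ.[ℂ] H) (s : ℝ) (v : H) : Prop :=
  ∃ x, IsOrbit A v x ∧ ∃ a c : ℝ, 0 < a ∧ 0 < c ∧
    ∀ k : ℕ, ‖x k‖ ≤ c * a ^ (2 * k) * ((2 * k).factorial : ℝ) ^ s

variable [CompleteSpace H] {A : H →ₗ.[ℂ] H} {s : ℝ} {v : H}

theorem IsGevreyVector.mem_functionalCalculusDomain_exp (h : IsGevreyVector A s v)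
    (hA : IsSelfAdjoint A) (hpos : IsNonnegativeOperator A.graph) (hs : 0 < s) :
    ∃ D : ℝ, 0 < D ∧
      v ∈ functionalCalculusDomain A (fun t => Real.exp (D * t ^ (1 / (2 * s)))) := by
  obtain ⟨x, hx, a, c, ha, hc, hle⟩ := h
  obtain ⟨E, hE⟩ := exists_isSpectralMeasureOf hA hpos
  have hnonneg := hE.ae_nonneg hA.dense_domain hpos v
  have hmoment (k : ℕ) : ∫⁻ t, ENNReal.ofReal (t ^ (2 * k)) ∂(E.scalarMeasure v) ≤
      ENNReal.ofReal (c ^ 2 * (a ^ 2) ^ (2 * k) * ((2 * k).factorial : ℝ) ^ (2 * s)) := by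
    rw [← hE.enorm_orbit_sq hA.dense_domain hx, rpow_two_mul_eq_sq (by positivity), pow_right_comm,
      ← mul_pow, ← mul_pow]
    exact (enorm_sq_le_ofReal_sq_iff (by positivity)).2 (hle k)
  refine ⟨(2 * Real.exp 1 * a ^ 2)⁻¹ ^ (1 / (2 * s)) / 2, by positivity, E, hE, ?_⟩
  refine lt_of_eq_of_lt (lintegral_congr_ae ?_) <|
    lintegral_exp_lt_top_of_lintegral_pow_le hnonneg (by positivity) (by positivity)
      (by positivity) hmoment
  filter_upwards [hnonneg] with t ht
  rw [sq_abs, ← Real.exp_nat_mul, div_eq_mul_inv t, Real.mul_rpow ht (by positivity)]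
  push_cast
  ring_nf

theorem isGevreyVector_of_mem_functionalCalculusDomain_exp {D : ℝ} (hA : IsSelfAdjoint A)
    (hpos : IsNonnegativeOperator A.graph) (hs : 0 < s) (hD : 0 < D)
    (h : v ∈ functionalCalculusDomain A (fun t => Real.exp (D * t ^ (1 / (2 * s))))) :
    IsGevreyVector A s v := by
  obtain ⟨E, hE, hint⟩ := h
  simp only [sq_abs, ← Real.exp_nat_mul, ← mul_assoc, Nat.cast_ofNat] at hint
  set I := ∫⁻ t, ENNReal.ofReal (Real.exp (2 * D * t ^ (1 / (2 * s)))) ∂(E.scalarMeasure v)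
  have hmoment (m : ℕ) := lintegral_pow_le_mul_lintegral_exp
    (hE.ae_nonneg hA.dense_domain hpos v) (q := 2 * s) (by positivity) (D := 2 * D)
    (by positivity) m
  obtain ⟨x, hx⟩ := hE.exists_isOrbit hA.dense_domain fun k =>
    (hmoment (2 * k)).trans_lt (ENNReal.mul_lt_top ENNReal.ofReal_lt_top hint)
  refine ⟨x, hx, (s / D) ^ s, √I.toReal + 1, by positivity, by positivity, fun k => ?_⟩
  refine (enorm_sq_le_ofReal_sq_iff (by positivity)).1 ?_
  calc ‖x k‖ₑ ^ 2
      ≤ ENNReal.ofReal (((2 * s / (2 * D)) ^ (2 * k) * (2 * k).factorial) ^ (2 * s)) * I :=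
        (hE.enorm_orbit_sq hA.dense_domain hx k).trans_le (hmoment (2 * k))
    _ = ENNReal.ofReal ((√I.toReal * ((s / D) ^ s) ^ (2 * k) *
          ((2 * k).factorial : ℝ) ^ s) ^ 2) := by
        rw [← ENNReal.ofReal_toReal hint.ne, ← ENNReal.ofReal_mul (by positivity),
          mul_div_mul_left _ _ two_ne_zero, rpow_two_mul_eq_sq (by positivity),
          Real.mul_rpow (by positivity) (by positivity), ← Real.rpow_pow_comm (by positivity),
          mul_assoc √_, mul_pow √_, Real.sq_sqrt ENNReal.toReal_nonneg, mul_comm,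
          ENNReal.toReal_ofReal ENNReal.toReal_nonneg]
    _ ≤ _ := by
        gcongr
        linarith

theorem isGevreyVector_iff (hA : IsSelfAdjoint A) (hpos : IsNonnegativeOperator A.graph)
    (hs : 0 < s) :
    IsGevreyVector A s v ↔ ∃ D : ℝ, 0 < D ∧
      v ∈ functionalCalculusDomain A (fun t => Real.exp (D * t ^ (1 / (2 * s)))) :=
  ⟨fun h => h.mem_functionalCalculusDomain_exp hA hpos hs, fun ⟨_, hD, h⟩ =>
    isGevreyVector_of_mem_functionalCalculusDomain_exp hA hpos hs hD h⟩

end GevreyVector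

/-! ### Local operators on manifolds -/

section LocalOperator

open Filter Topology

variable {E : Type*} [NormedAddCommGroup E] [NormedSpace ℝ E] {H : Type*} [TopologicalSpace H]
  (I : ModelWithCorners ℝ E H) {M : Type*} [TopologicalSpace M] [ChartedSpace H M]

/-- An operator on the smooth complex-valued functions on `M` which, like every differential
operator, does not enlarge supports. It is encoded as an operator on all functions, whose values
at functions which are not smooth are irrelevant; linearity is not required. -/
structure IsLocalOperator (P : (M → ℂ) → M → ℂ) : Prop where
  contMDiff {f : M → ℂ} : ContMDiff I 𝓘(ℝ, ℂ) ∞ f → ContMDiff I 𝓘(ℝ, ℂ) ∞ (P f)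
  congr {f g : M → ℂ} {x : M} : ContMDiff I 𝓘(ℝ, ℂ) ∞ f → ContMDiff I 𝓘(ℝ, ℂ) ∞ g →
    f =ᶠ[𝓝 x] g → P f x = P g x
  map_zero : P 0 = 0

/-- The graph of `P` as an operator on `L²(M, μ)` with domain the smooth functions `f` such that
`f` and `P f` are square-integrable. -/
def smoothGraph [MeasurableSpace M] (μ : Measure M) (P : (M → ℂ) → M → ℂ) :
    Set (Lp ℂ 2 μ × Lp ℂ 2 μ) :=
  {p | ∃ f : M → ℂ, ContMDiff I 𝓘(ℝ, ℂ) ∞ f ∧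
    ∃ (hf : MemLp f 2 μ) (hPf : MemLp (P f) 2 μ), p = (hf.toLp f, hPf.toLp (P f))}

variable {I}

theorem exists_contMDiff_hasCompactSupport_eventuallyEq [FiniteDimensional ℝ E] [IsManifold I ∞ M]
    [T2Space M] [SigmaCompactSpace M] {f : M → ℂ} (hf : ContMDiff I 𝓘(ℝ, ℂ) ∞ f) {K : Set M}
    (hK : IsCompact K) :
    ∃ g : M → ℂ, ContMDiff I 𝓘(ℝ, ℂ) ∞ g ∧ HasCompactSupport g ∧ ∀ x ∈ K, g =ᶠ[𝓝 x] f := by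
  have := Manifold.locallyCompact_of_finiteDimensional (M := M) I
  obtain ⟨K', hK', hKK'⟩ := exists_compact_superset hK
  obtain ⟨χ, hχ1, hχ0, -⟩ :=
    exists_contMDiffMap_one_nhds_of_subset_interior (n := (⊤ : ℕ∞)) I hK.isClosed hKK'
  refine ⟨fun x => χ x • f x, χ.contMDiff.smul hf, .intro hK' fun x hx => ?_, fun x hx => ?_⟩
  · rw [hχ0 x hx, zero_smul]
  · filter_upwards [hχ1.filter_mono (nhds_le_nhdsSet hx)] with y hy
    rw [hy, one_smul]

theorem inner_toLp_toLp {α : Type*} [MeasurableSpace α] {μ : Measure α} {f g : α → ℂ}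
    (hf : MemLp f 2 μ) (hg : MemLp g 2 μ) :
    inner ℂ (hf.toLp f) (hg.toLp g) = ∫ x, inner ℂ (f x) (g x) ∂μ := by
  rw [L2.inner_def]
  refine integral_congr_ae ?_
  filter_upwards [hf.coeFn_toLp, hg.coeFn_toLp] with x hx hx'
  rw [hx, hx']

namespace IsLocalOperator

variable {P : (M → ℂ) → M → ℂ} (hP : IsLocalOperator I P) {f u : M → ℂ}

include hP

theorem contMDiff_iterate (hf : ContMDiff I 𝓘(ℝ, ℂ) ∞ f) (k : ℕ) :
    ContMDiff I 𝓘(ℝ, ℂ) ∞ (P^[k] f) :=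
  Function.Iterate.rec _ hf (fun _ => hP.contMDiff) k

theorem tsupport_subset (hf : ContMDiff I 𝓘(ℝ, ℂ) ∞ f) : tsupport (P f) ⊆ tsupport f := by
  refine closure_minimal (fun x => not_imp_comm.1 fun hx => ?_) (isClosed_tsupport f)
  rw [notMem_tsupport_iff_eventuallyEq] at hx
  exact (hP.congr hf contMDiff_const hx).trans (congrFun hP.map_zero x)

theorem hasCompactSupport (hf : ContMDiff I 𝓘(ℝ, ℂ) ∞ f) (hfc : HasCompactSupport f) :
    HasCompactSupport (P f) :=
  hfc.of_isClosed_subset (isClosed_tsupport _) (hP.tsupport_subset hf)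

variable [MeasurableSpace M] [BorelSpace M] {μ : Measure M} [IsLocallyFiniteMeasure μ]

theorem toLp_mem_smoothGraph_of_hasCompactSupport (hf : ContMDiff I 𝓘(ℝ, ℂ) ∞ f)
    (hfc : HasCompactSupport f) :
    ∃ (hf2 : MemLp f 2 μ) (hPf2 : MemLp (P f) 2 μ),
      (hf2.toLp f, hPf2.toLp (P f)) ∈ smoothGraph I μ P := by
  have hf2 : MemLp f 2 μ := hf.continuous.memLp_of_hasCompactSupport hfc
  have hPf2 : MemLp (P f) 2 μ :=
    (hP.contMDiff hf).continuous.memLp_of_hasCompactSupport (hP.hasCompactSupport hf hfc)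
  exact ⟨hf2, hPf2, f, hf, hf2, hPf2, rfl⟩

variable [FiniteDimensional ℝ E] [IsManifold I ∞ M] [T2Space M] [SigmaCompactSpace M]
  {A : Lp ℂ 2 μ →ₗ.[ℂ] Lp ℂ 2 μ}

theorem integral_inner_eq (hA : IsSelfAdjoint A) (hPA : smoothGraph I μ P ⊆ A.graph)
    (hu : ContMDiff I 𝓘(ℝ, ℂ) ∞ u) (huc : HasCompactSupport u) (hf : ContMDiff I 𝓘(ℝ, ℂ) ∞ f) :
    ∫ x, inner ℂ (P u x) (f x) ∂μ = ∫ x, inner ℂ (u x) (P f x) ∂μ := by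
  obtain ⟨w, hw, hwc, hwf⟩ := exists_contMDiff_hasCompactSupport_eventuallyEq hf huc
  obtain ⟨hu2, hPu2, hmem_u⟩ := hP.toLp_mem_smoothGraph_of_hasCompactSupport (μ := μ) hu huc
  obtain ⟨hw2, hPw2, hmem_w⟩ := hP.toLp_mem_smoothGraph_of_hasCompactSupport (μ := μ) hw hwc
  calc ∫ x, inner ℂ (P u x) (f x) ∂μ = ∫ x, inner ℂ (P u x) (w x) ∂μ := by
        congr! 2 with x
        by_cases hx : x ∈ tsupport u
        · rw [(hwf x hx).eq_of_nhds]
        · simp only [image_eq_zero_of_notMem_tsupport fun h => hx (hP.tsupport_subset hu h),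
            inner_zero_left]
    _ = ∫ x, inner ℂ (u x) (P w x) ∂μ := by
        rw [← inner_toLp_toLp hPu2 hw2, ← inner_toLp_toLp hu2 hPw2]
        exact (mem_graph_iff_of_isSelfAdjoint hA).1 (hPA hmem_w) _ (hPA hmem_u)
    _ = ∫ x, inner ℂ (u x) (P f x) ∂μ := by
        congr! 2 with x
        by_cases hx : x ∈ tsupport u
        · rw [hP.congr hw hf (hwf x hx)]
        · simp only [image_eq_zero_of_notMem_tsupport hx, inner_zero_left]

theorem ae_eq_of_mem_graph (hA : IsSelfAdjoint A) (hPA : smoothGraph I μ P ⊆ A.graph)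
    (hf : ContMDiff I 𝓘(ℝ, ℂ) ∞ f) {hf2 : MemLp f 2 μ} {g : Lp ℂ 2 μ}
    (hg : (hf2.toLp f, g) ∈ A.graph) : g =ᵐ[μ] P f := by
  have := Manifold.locallyCompact_of_finiteDimensional (M := M) I
  refine ae_eq_of_integral_contMDiff_smul_eq I ((Lp.memLp g).locallyIntegrable (by norm_num))
    (hP.contMDiff hf).continuous.locallyIntegrable fun h hh hhc => ?_
  let u : M → ℂ := fun x => h x
  have hu : ContMDiff I 𝓘(ℝ, ℂ) ∞ u := Complex.ofRealCLM.contMDiff.comp hh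
  have huc : HasCompactSupport u := hhc.comp_left Complex.ofReal_zero
  have hsmul (x : M) (z : ℂ) : h x • z = inner ℂ (u x) z := by
    rw [Complex.real_smul, RCLike.inner_apply', Complex.conj_ofReal]
  obtain ⟨hu2, hPu2, hmem_u⟩ := hP.toLp_mem_smoothGraph_of_hasCompactSupport (μ := μ) hu huc
  simp only [hsmul]
  calc ∫ x, inner ℂ (u x) (g x) ∂μ = inner ℂ (hu2.toLp u) g := by
        rw [← inner_toLp_toLp hu2 (Lp.memLp g), Lp.toLp_coeFn]
    _ = inner ℂ (hPu2.toLp (P u)) (hf2.toLp f) :=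
        ((mem_graph_iff_of_isSelfAdjoint hA).1 hg _ (hPA hmem_u)).symm
    _ = ∫ x, inner ℂ (P u x) (f x) ∂μ := inner_toLp_toLp hPu2 hf2
    _ = ∫ x, inner ℂ (u x) (P f x) ∂μ := hP.integral_inner_eq hA hPA hu huc hf

theorem exists_isOrbit_iff (hA : IsSelfAdjoint A) (hPA : smoothGraph I μ P ⊆ A.graph)
    (hf : ContMDiff I 𝓘(ℝ, ℂ) ∞ f) {b : ℕ → ℝ} (hb : ∀ k, 0 ≤ b k) :
    (∀ k, eLpNorm (P^[k] f) 2 μ ≤ ENNReal.ofReal (b k)) ↔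
      ∃ hf2 : MemLp f 2 μ, ∃ x, IsOrbit A (hf2.toLp f) x ∧ ∀ k, ‖x k‖ ≤ b k := by
  have hsmooth := hP.contMDiff_iterate hf
  have hnorm {k : ℕ} (hk : MemLp (P^[k] f) 2 μ) :
      eLpNorm (P^[k] f) 2 μ ≤ ENNReal.ofReal (b k) ↔ ‖hk.toLp _‖ ≤ b k := by
    rw [Lp.norm_toLp, ENNReal.le_ofReal_iff_toReal_le hk.eLpNorm_ne_top (hb k)]
  constructor
  · intro h
    have hmem (k : ℕ) : MemLp (P^[k] f) 2 μ :=
      ⟨(hsmooth k).continuous.aestronglyMeasurable, (h k).trans_lt ENNReal.ofReal_lt_top⟩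
    refine ⟨hmem 0, fun k => (hmem k).toLp _, ⟨rfl, fun k => hPA ?_⟩,
      fun k => (hnorm (hmem k)).1 (h k)⟩
    refine ⟨P^[k] f, hsmooth k, hmem k, ?_⟩
    simp only [← Function.iterate_succ_apply' P]
    exact ⟨hmem (k + 1), trivial⟩
  · rintro ⟨hf2, x, hx, hle⟩ k
    suffices h : ∃ hk : MemLp (P^[k] f) 2 μ, hk.toLp _ = x k by
      obtain ⟨hk, hkx⟩ := h
      exact (hnorm hk).2 (hkx ▸ hle k)
    induction k with
    | zero => exact ⟨hf2, hx.1.symm⟩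
    | succ k ih =>
      obtain ⟨hk, hkx⟩ := ih
      have hae := hP.ae_eq_of_mem_graph hA hPA (hsmooth k) (hkx ▸ hx.2 k)
      rw [Function.iterate_succ_apply']
      have hk' := (memLp_congr_ae hae).1 (Lp.memLp (x (k + 1)))
      exact ⟨hk', Lp.ext (hk'.coeFn_toLp.trans hae.symm)⟩

end IsLocalOperator

end LocalOperator

section SubLaplacianIsLocal

open Filter Topology

variable {n : ℕ} {M : Type*} [TopologicalSpace M] [ChartedSpace (EuclideanSpace ℝ (Fin n)) M]

theorem applyField_congr {V : (x : M) → TangentSpace (𝓡 n) x} {f g : M → ℂ} {x : M}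
    (h : f =ᶠ[𝓝 x] g) : applyField V f =ᶠ[𝓝 x] applyField V g := by
  filter_upwards [h.eventuallyEq_nhds] with y hy
  simp only [applyField, hy.mfderiv_eq]
  rfl

theorem applyField_zero (V : (x : M) → TangentSpace (𝓡 n) x) : applyField V 0 = 0 := by
  ext x
  have h : mfderiv (𝓡 n) 𝓘(ℝ, ℂ) (0 : M → ℂ) x = 0 := mfderiv_const
  simp only [applyField, h]
  rfl

theorem isLocalOperator_subLaplacian [IsManifold (𝓡 n) ∞ M] {r : ℕ}
    {X : Fin r → (x : M) → TangentSpace (𝓡 n) x}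
    (hX : ∀ j, ContMDiff (𝓡 n) (𝓡 n).tangent ∞
      (fun x => (⟨x, X j x⟩ : TangentBundle (𝓡 n) M))) :
    IsLocalOperator (𝓡 n) (subLaplacian X) where
  contMDiff hf := (contMDiff_finsetSum fun j _ =>
    contMDiff_applyField (hX j) (contMDiff_applyField (hX j) hf)).neg
  congr _ _ h := congrArg Neg.neg <| Finset.sum_congr rfl fun _ _ =>
    (applyField_congr (applyField_congr h)).eq_of_nhds
  map_zero := by
    ext x
    simp only [subLaplacian, applyField_zero, Pi.zero_apply, Finset.sum_const_zero, neg_zero]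

end SubLaplacianIsLocal

section GevreyFunctions

variable {E : Type*} [NormedAddCommGroup E] [NormedSpace ℝ E] [FiniteDimensional ℝ E]
  {H : Type*} [TopologicalSpace H] {I : ModelWithCorners ℝ E H}
  {M : Type*} [TopologicalSpace M] [ChartedSpace H M] [IsManifold I ∞ M] [T2Space M]
  [SigmaCompactSpace M] [MeasurableSpace M] [BorelSpace M]
  {μ : Measure M} [IsLocallyFiniteMeasure μ] {P : (M → ℂ) → M → ℂ}
  {A : Lp ℂ 2 μ →ₗ.[ℂ] Lp ℂ 2 μ}

theorem proposition4p3_general (hP : IsLocalOperator I P) (hA : IsSelfAdjoint A)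
    (hpos : IsNonnegativeOperator A.graph) (hPA : smoothGraph I μ P ⊆ A.graph)
    {s : ℝ} (hs : 0 < s) {φ : M → ℂ} (hφ : ContMDiff I 𝓘(ℝ, ℂ) ∞ φ) :
    (∃ a c : ℝ, 0 < a ∧ 0 < c ∧ ∀ k : ℕ,
      eLpNorm (P^[k] φ) 2 μ ≤ ENNReal.ofReal (c * a ^ (2 * k) * ((2 * k).factorial : ℝ) ^ s)) ↔
    (∃ D : ℝ, 0 < D ∧ ∃ hφ2 : MemLp φ 2 μ, hφ2.toLp φ ∈
      functionalCalculusDomain A (fun t => Real.exp (D * t ^ (1 / (2 * s))))) := by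
  trans ∃ hφ2 : MemLp φ 2 μ, IsGevreyVector A s (hφ2.toLp φ)
  · constructor
    · rintro ⟨a, c, ha, hc, h⟩
      obtain ⟨hφ2, x, hx, hle⟩ :=
        (hP.exists_isOrbit_iff hA hPA hφ fun k => by positivity).1 h
      exact ⟨hφ2, x, hx, a, c, ha, hc, hle⟩
    · rintro ⟨hφ2, x, hx, a, c, ha, hc, hle⟩
      exact ⟨a, c, ha, hc,
        (hP.exists_isOrbit_iff hA hPA hφ fun k => by positivity).2 ⟨hφ2, x, hx, hle⟩⟩
  · simp only [isGevreyVector_iff hA hpos hs]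
    exact ⟨fun ⟨hφ2, D, hD, h⟩ => ⟨D, hD, hφ2, h⟩, fun ⟨D, hD, hφ2, h⟩ => ⟨hφ2, D, hD, h⟩⟩

end GevreyFunctions

theorem proposition4p3 {n : ℕ} {M : Type*} [TopologicalSpace M] [T2Space M]
    [SecondCountableTopology M] [ChartedSpace (EuclideanSpace ℝ (Fin n)) M]
    [IsManifold (𝓡 n) ∞ M] [MeasurableSpace M] [BorelSpace M]
    (μ : Measure M) [IsLocallyFiniteMeasure μ]
    {r : ℕ} (X : Fin r → (x : M) → TangentSpace (𝓡 n) x) (hX : IsHormanderSystem X)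
    (hsa : IsEssentiallySelfAdjoint (subLaplacianGraph μ hX))
    (hnonneg : IsNonnegativeOperator (subLaplacianGraph μ hX))
    (s : ℝ) (hs : 0 < s) (φ : M → ℂ) (hφ : ContMDiff (𝓡 n) 𝓘(ℝ, ℂ) ∞ φ) :
    (∃ A C : ℝ, 0 < A ∧ 0 < C ∧ ∀ k : ℕ,
      eLpNorm ((subLaplacian X)^[k] φ) 2 μ ≤
        ENNReal.ofReal (C * A ^ (2 * k) * ((Nat.factorial (2 * k) : ℕ) : ℝ) ^ s)) ↔
    (∃ D : ℝ, 0 < D ∧ ∃ hφ2 : MemLp φ 2 μ,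
      hφ2.toLp φ ∈ functionalCalculusDomain (operatorClosure (subLaplacianGraph μ hX))
        (fun t => Real.exp (D * t ^ (1 / (2 * s))))) := by
  obtain ⟨hA, hgraph⟩ := hsa.closure_spec
  have := Manifold.locallyCompact_of_finiteDimensional (M := M) (𝓡 n)
  exact proposition4p3_general (isLocalOperator_subLaplacian hX.smooth) hA
    (hgraph ▸ hnonneg.topologicalClosure)
    (fun _ h => hgraph ▸ (subLaplacianGraph μ hX).le_topologicalClosure h) hs hφ
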